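/- **Online weighted paging with unknown weights (OWP-UW).** A cache has $k\ge 1$ slots and is initially empty. An input $Q$ consists of a sequence of $T$ page requests $p_1,\dots,p_T$ and, for every page $p$, a probability distribution $\mathcal D_p$ supported in $(0,1]$ with mean $w_p$, the weight of $p$. Let $n$ be the number of distinct requested pages, and assume $n>k$. The requests arrive one at a time. In each round, the online algorithm may evict pages from the cache and fetch pages that have been requested so far (including the current request) into empty slots; the round ends with the requested page in the cache. Each eviction of a page $p$ costs $w_p$ and immediately reveals to the algorithm a fresh independent sample from $\mathcal D_p$; fetching is free. The algorithm knows $k$ and $T$, but it does not know $n$, the future requests, the weights or the distributions; each of its decisions depends only on its internal randomness, on the requests that have arrived, on its own earlier operations and on the samples received so far. $\mathrm{ON}(Q)$ denotes its total eviction cost, and $\mathrm{OPT}(Q)$ denotes the minimum total eviction cost of an offline solution with $k$ slots, which starts from the empty cache and knows all of $Q$. **Theorem.** There are absolute constants $C_1,C_2$ and $c\in\mathbb N$ and, for all $k\ge 1$ and $T$, a randomized online algorithm $\mathrm{ON}$ for OWP-UW which serves every request of every sequence of $T$ requests, such that for every input $Q$ with $T$ requests and $n>k$ distinct requested pages $$\mathbb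 E[\mathrm{ON}(Q)]\;\le\; C_1\log(k+1)\cdot \mathrm{OPT}(Q)\;+\;C_2\,\sqrt{nT}\,\bigl(\log(nT)\bigr)^{c},$$ that is, $\mathbb E[\mathrm{ON}(Q)]\le O(\log k)\cdot\mathrm{OPT}(Q)+\tilde O(\sqrt{nT})$. The expectation is taken over both the randomness of the algorithm and the samples from the distributions of the pages. -/

import Mathlib

open MeasureTheory

namespace OWPUW

/-- An input for online weighted paging with unknown weights: the request sequence, and for every
page a probability distribution supported in `(0, 1]`. -/
structure Input (Page : Type) where
  requests : List Page
  dist : Page → Measure ℝ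
  isProb : ∀ p, IsProbabilityMeasure (dist p)
  support : ∀ p, ∀ᵐ x ∂(dist p), x ∈ Set.Ioc (0 : ℝ) 1

attribute [instance] Input.isProb

namespace Input

variable {Page : Type}

/-- The number `T` of requests. -/
def numRequests (Q : Input Page) : ℕ := Q.requests.length

/-- The number `n` of distinct requested pages. -/
def numPages [DecidableEq Page] (Q : Input Page) : ℕ := Q.requests.toFinset.card

/-- The weight of a page: the expectation of its distribution. -/
noncomputable def weight (Q : Input Page) (p : Page) : ℝ := ∫ x, x ∂(Q.dist p)

/-- The joint law of all samples: coordinate `(p, i)` is the sample revealed by the eviction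
number `i` (counted from zero) of page `p`; the coordinates are independent. -/
noncomputable def sampleLaw (Q : Input Page) : Measure (Page × ℕ → ℝ) :=
  Measure.infinitePi (fun i : Page × ℕ => Q.dist i.1)

/-- An offline solution with `k` slots, starting from the empty cache: `C t` is the cache content
after the first `t` requests have been served. -/
structure IsSchedule (Q : Input Page) (k : ℕ) (C : ℕ → Finset Page) : Prop where
  start : C 0 = ∅
  card_le : ∀ t, (C t).card ≤ k
  serves : ∀ (t : ℕ) (ht : t < Q.requests.length), Q.requests[t] ∈ C (t + 1)

/-- The total weight of the pages that an offline solution evicts. -/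
noncomputable def scheduleCost [DecidableEq Page] (Q : Input Page) (C : ℕ → Finset Page) : ℝ :=
  ∑ t ∈ Finset.range Q.numRequests, ∑ p ∈ C t \ C (t + 1), Q.weight p

/-- The cost of the optimal offline solution with `k` slots. -/
noncomputable def opt [DecidableEq Page] (Q : Input Page) (k : ℕ) : ℝ :=
  sInf {c : ℝ | ∃ C : ℕ → Finset Page, Q.IsSchedule k C ∧ Q.scheduleCost C = c}

end Input

/-- Elementary operations of an online algorithm: evict a page, fetch a page, or declare the
current request served (which ends the round). -/
inductive Op (Page : Type) where
  | evict (p : Page)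
  | fetch (p : Page)
  | serve
  deriving DecidableEq

/-- Operations carry the discrete σ-algebra. -/
instance (Page : Type) : MeasurableSpace (Op Page) := ⊤

/-- A randomized online algorithm. A random seed is drawn once. The next operation is a function
of the seed and of what has been observed: the requests that have arrived (in order of arrival,
the last one being the current request), the operations performed so far (latest first), and the
samples received so far (latest first, one for each eviction). -/
structure OnlineAlgorithm (Page : Type) where
  Seed : Type
  seedSpace : MeasurableSpace Seed
  seedLaw : Measure Seed
  seedProb : IsProbabilityMeasure seedLaw
  next : Seed → List Page → List (Op Page) → List ℝ → Op Page
  measurable_next : ∀ (reqs : List Page) (ops : List (Op Page)) (m : ℕ),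
    Measurable (fun z : Seed × (Fin m → ℝ) => next z.1 reqs ops (List.ofFn z.2))

attribute [instance] OnlineAlgorithm.seedSpace OnlineAlgorithm.seedProb

/-- The state of a run: the number of requests already served, the cache content, and the
operations performed and samples received so far (latest first). -/
structure State (Page : Type) where
  served : ℕ
  cache : Finset Page
  ops : List (Op Page)
  samples : List ℝ

namespace OnlineAlgorithm

variable {Page : Type} [DecidableEq Page]

/-- One operation of the algorithm with `k` slots on the request sequence `reqs`, where `ω` is the
seed and `X (p, i)` is the sample revealed by eviction number `i` of page `p`. A page can be
evicted only if it is in the cache. It can be fetched only if it has been requested before or is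
the current request, is not in the cache, and the cache has an empty slot. A round can be ended
only if the current request is in the cache. An illegal operation leaves the state unchanged, so
that the run is stuck from then on. -/
def step (A : OnlineAlgorithm Page) (k : ℕ) (reqs : List Page) (ω : A.Seed)
    (X : Page × ℕ → ℝ) (s : State Page) : State Page :=
  match reqs[s.served]? with
  | none => s
  | some p =>
    match A.next ω (reqs.take (s.served + 1)) s.ops s.samples with
    | .evict q =>
      if q ∈ s.cache then
        { served := s.served
          cache := s.cache.erase q
          ops := .evict q :: s.ops
          samples := X (q, s.ops.count (.evict q)) :: s.samples }
      else s
    | .fetch q =>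
      if q ∈ reqs.take (s.served + 1) ∧ q ∉ s.cache ∧ s.cache.card < k then
        { served := s.served
          cache := insert q s.cache
          ops := .fetch q :: s.ops
          samples := s.samples }
      else s
    | .serve =>
      if p ∈ s.cache then
        { served := s.served + 1
          cache := s.cache
          ops := .serve :: s.ops
          samples := s.samples }
      else s

/-- The state after `N` operations, starting from the empty cache. -/
def run (A : OnlineAlgorithm Page) (k : ℕ) (reqs : List Page) (ω : A.Seed)
    (X : Page × ℕ → ℝ) (N : ℕ) : State Page :=
  (A.step k reqs ω X)^[N] { served := 0, cache := ∅, ops := [], samples := [] }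

/-- The algorithm is correct for `k` slots and `T` requests: whatever the requests, the seed and
the sample values are, all requests get served after finitely many operations. -/
def ServesAll (A : OnlineAlgorithm Page) (k T : ℕ) : Prop :=
  ∀ reqs : List Page, reqs.length = T → ∀ (ω : A.Seed) (X : Page × ℕ → ℝ),
    (∀ i, X i ∈ Set.Ioc (0 : ℝ) 1) → ∃ N, (A.run k reqs ω X N).served = T

end OnlineAlgorithm

/-- The cost of an operation: evicting a page costs its weight, all else is free. -/
def Op.cost {Page : Type} (w : Page → ℝ) : Op Page → ℝ
  | .evict p => w p
  | .fetch _ => 0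
  | .serve => 0

namespace OnlineAlgorithm

variable {Page : Type} [DecidableEq Page]

/-- The total eviction cost of the whole run, for a given seed and given samples. -/
noncomputable def cost (A : OnlineAlgorithm Page) (k : ℕ) (Q : Input Page) (ω : A.Seed)
    (X : Page × ℕ → ℝ) : ENNReal :=
  ⨆ N : ℕ, ENNReal.ofReal (((A.run k Q.requests ω X N).ops.map (Op.cost Q.weight)).sum)

/-- The expected cost, over the randomness of the algorithm and the independent samples. -/
noncomputable def expectedCost (A : OnlineAlgorithm Page) (k : ℕ) (Q : Input Page) : ENNReal :=
  ∫⁻ z : A.Seed × (Page × ℕ → ℝ), A.cost k Q z.1 z.2 ∂(A.seedLaw.prod Q.sampleLaw)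

end OnlineAlgorithm

end OWPUW

/-! The algorithm solves weighted paging fractionally with optimistic estimates of the weights,
rounds the solution to `T + 1` deterministic caches (lanes), and runs one lane chosen uniformly at
random.

Fractional part. Every page has a missing fraction `y`. A request sets `y` to 0 for the requested
page; then the fractions of the other pages seen so far grow at rate `(y + 1/k) / weight` until at
most `k - 1` units of these pages remain. This growth is paid by a logarithmic potential over the
pages that the competitor does not hold (`growth_step`, `exists_growth`). An eviction by the
competitor raises this potential by at most `log (2k + 1)` times the weight, which is the source of
the factor `O(log k)`.

Rounding. A page lies in about `(1 - y)(T + 1)` lanes, and for every prefix of the weight classes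
`2⁻ᶜ` any two lanes hold equally many pages up to one. Changing one multiplicity in class `c` causes
a cascade of at most one move in each class from `c` on, so the cost is a geometric sum of order
`2⁻ᶜ` (`exists_rebalanced`). Balance for the full prefix keeps every lane within `k` slots.

Learning. The estimate is a lower confidence bound. A new sample of `p` is used only when `p` is
requested and the lazy lanes have together paid `T + 1` evictions of `p` for it; then every lane
evicts and refetches `p`. Hence every lane owns all samples that the simulation uses, so a single
lane can simulate all of them; sampling at most doubles the cost. At this moment `p` is in every
lane, in the competitor's cache and has `y = 0`, so a new estimate disturbs neither balance nor
potentials (`Balanced.change_class`, `round_cost_le`).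

Accounting. If the samples are concentrated, the estimates never exceed the true weights by more
than `2⁻ᵀ`, so the estimated cost is `O(log k)` times the competitor's cost plus `O(n + log k)`
(`sum_charge_le`). An estimate below a sixteenth of the weight `w` is possible only during the first
`O(log T) / w` samples, which costs `O(log T)` per page (`weight_mul_D_le`,
`weight_mul_m_le_of_concentrated`). The additive loss is thus `O(n log (nT))`, and `n ≤ √(nT)` since
`n ≤ T`. The bad event has probability `O(T⁻¹)`, while the average lane cost is never above `2T`. -/

namespace OWPUW

/-! ### Balanced lanes and the cost of rebalancing them -/

section Lanes

variable {Page ι : Type} [DecidableEq Page] [Fintype ι] [DecidableEq ι]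

/-- The number of pages of class below `j` in lane `i`. -/
def level (cl : Page → ℕ) (V : ι → Finset Page) (j : ℕ) (i : ι) : ℕ :=
  ((V i).filter (fun q => cl q < j)).card

/-- A family of lanes is balanced if, for every `j`, any two lanes hold the same number of pages of
class below `j`, up to one. -/
def Balanced (cl : Page → ℕ) (V : ι → Finset Page) : Prop :=
  ∀ j i i', level cl V j i ≤ level cl V j i' + 1

/-- The number of lanes that hold page `q`. -/
def mult (V : ι → Finset Page) (q : Page) : ℕ := (Finset.univ.filter (fun i => q ∈ V i)).card

/-- The weighted number of pages that leave their lanes. -/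
noncomputable def evictCost (w : Page → ℝ) (V V' : ι → Finset Page) : ℝ :=
  ∑ i, ∑ q ∈ V i \ V' i, w q

omit [DecidableEq ι] in
lemma evictCost_triangle {w : Page → ℝ} (hw : ∀ q, 0 ≤ w q) (U V W : ι → Finset Page) :
    evictCost w U W ≤ evictCost w U V + evictCost w V W := by
  unfold evictCost
  rw [← Finset.sum_add_distrib]
  refine Finset.sum_le_sum fun i _ => ?_
  calc ∑ q ∈ U i \ W i, w q ≤ ∑ q ∈ (U i \ V i) ∪ (V i \ W i), w q := by
        refine Finset.sum_le_sum_of_subset_of_nonneg ?_ fun q _ _ => hw q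
        intro q
        simp only [Finset.mem_sdiff, Finset.mem_union]
        tauto
    _ ≤ _ := by
        rw [← Finset.sum_union_inter]
        have : 0 ≤ ∑ q ∈ (U i \ V i) ∩ (V i \ W i), w q := Finset.sum_nonneg fun q _ => hw q
        linarith

/-- Subtracting the two hypotheses, lane `a` holds strictly more pages of class exactly `j` than
lane `b`, so some page of class `j` can be moved from `a` to `b`. The move is invisible to prefixes
up to `j`. -/
lemma exists_move (cl : Page → ℕ) (V : ι → Finset Page) (j : ℕ) (a b : ι)
    (h1 : level cl V j a ≤ level cl V j b + 1)
    (h2 : level cl V (j + 1) b + 2 ≤ level cl V (j + 1) a) :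
    ∃ V' : ι → Finset Page, mult V' = mult V ∧
      (∀ j' ≤ j, ∀ i, level cl V' j' i = level cl V j' i) ∧
      (∀ j', j < j' → ∀ i, (level cl V' j' i : ℤ) =
        level cl V j' i - (if i = a then 1 else 0) + (if i = b then 1 else 0)) ∧
      evictCost (fun q => (1 / 2 : ℝ) ^ cl q) V V' ≤ (1 / 2) ^ j := by
  have hab : a ≠ b := by rintro rfl; omega
  have split : ∀ i, level cl V (j + 1) i
      = level cl V j i + ((V i).filter (fun q => cl q = j)).card := by
    intro i
    unfold level
    rw [← Finset.card_union_of_disjoint]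
    · congr 1
      ext q
      simp only [Finset.mem_filter, Finset.mem_union]
      constructor
      · rintro ⟨h, h'⟩
        rcases Nat.lt_succ_iff_lt_or_eq.1 h' with h' | h' <;> tauto
      · rintro (⟨h, h'⟩ | ⟨h, h'⟩) <;> exact ⟨h, by omega⟩
    · rw [Finset.disjoint_left]
      intro q hq hq'
      simp only [Finset.mem_filter] at hq hq'
      omega
  obtain ⟨r, hra, hrb⟩ : ∃ r ∈ (V a).filter (fun q => cl q = j),
      r ∉ (V b).filter (fun q => cl q = j) := by
    by_contra! h
    have := Finset.card_le_card (show (V a).filter (fun q => cl q = j) ⊆ _ from h)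
    have h3 := split a
    have h4 := split b
    omega
  simp only [Finset.mem_filter] at hra hrb
  obtain ⟨hra, hrj⟩ := hra
  have hrb : r ∉ V b := fun h => hrb ⟨h, hrj⟩
  let V' : ι → Finset Page :=
    fun i => if i = a then (V a).erase r else if i = b then insert r (V b) else V i
  have hVa : V' a = (V a).erase r := by simp [V']
  have hVb : V' b = insert r (V b) := by simp [V', hab.symm]
  have hVo : ∀ i, i ≠ a → i ≠ b → V' i = V i := fun i h h' => by simp [V', h, h']
  refine ⟨V', ?_, ?_, ?_, ?_⟩
  · ext q
    unfold mult
    by_cases hq : q = r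
    · subst hq
      have : Finset.univ.filter (fun i => q ∈ V' i)
          = insert b ((Finset.univ.filter (fun i => q ∈ V i)).erase a) := by
        ext i
        simp only [Finset.mem_filter, Finset.mem_univ, true_and, Finset.mem_insert,
          Finset.mem_erase]
        by_cases hia : i = a
        · subst hia; simp [hVa, hab]
        · by_cases hib : i = b
          · subst hib; simp [hVb]
          · simp [hVo i hia hib, hia, hib]
      rw [this, Finset.card_insert_of_notMem, Finset.card_erase_add_one]
      · simpa using hra
      · simp [hrb]
    · congr 1
      ext i
      simp only [Finset.mem_filter, Finset.mem_univ, true_and]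
      by_cases hia : i = a
      · subst hia; simp [hVa, hq]
      · by_cases hib : i = b
        · subst hib; simp [hVb, hq]
        · rw [hVo i hia hib]
  · intro j' hj' i
    unfold level
    by_cases hia : i = a
    · subst hia
      rw [hVa, Finset.filter_erase, Finset.erase_eq_of_notMem]
      simp; omega
    · by_cases hib : i = b
      · subst hib
        rw [hVb, Finset.filter_insert, if_neg (by omega)]
      · rw [hVo i hia hib]
  · intro j' hj' i
    unfold level
    by_cases hia : i = a
    · subst hia
      rw [hVa, Finset.filter_erase, Finset.card_erase_of_mem (by simp [hra]; omega)]
      have : 0 < ((V i).filter (fun q => cl q < j')).card :=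
        Finset.card_pos.2 ⟨r, by simp [hra]; omega⟩
      simp [hab]
      omega
    · by_cases hib : i = b
      · subst hib
        rw [hVb, Finset.filter_insert, if_pos (by omega),
          Finset.card_insert_of_notMem (by simp [hrb])]
        simp [hia]
      · rw [hVo i hia hib]
        simp [hia, hib]
  · unfold evictCost
    rw [Finset.sum_eq_single a]
    · rw [hVa]
      have : V a \ (V a).erase r = {r} := by
        ext q
        simp only [Finset.mem_sdiff, Finset.mem_erase, Finset.mem_singleton]
        constructor
        · tauto
        · rintro rfl; tauto
      rw [this]
      simp [hrj]
    · intro i _ hia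
      by_cases hib : i = b
      · subst hib; simp [hVb, Finset.sdiff_eq_empty_iff_subset.2 (Finset.subset_insert r (V i))]
      · simp [hVo i hia hib]
    · simp

/-- All class prefixes up to `j` are balanced, and the others become so when `δ` is added to the
count of lane `i₀`. -/
def Defect (cl : Page → ℕ) (V : ι → Finset Page) (δ : ℤ) (i₀ : ι) (j : ℕ) : Prop :=
  (∀ j' ≤ j, ∀ i i', level cl V j' i ≤ level cl V j' i' + 1) ∧
  ∀ j', j < j' → ∀ i i', (level cl V j' i : ℤ) + (if i = i₀ then δ else 0) ≤
    level cl V j' i' + (if i' = i₀ then δ else 0) + 1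

/-- An imbalance at prefix `j + 1` must involve the defective lane. One move of a class `j` page
cures it there and hands the defect, with the same sign, to the other lane of the move, for the
longer prefixes only. -/
lemma Defect.step {cl : Page → ℕ} {V : ι → Finset Page} {δ : ℤ} (hδ : δ = 1 ∨ δ = -1) {i₀ : ι}
    {j : ℕ} (h : Defect cl V δ i₀ j) :
    ∃ (V' : ι → Finset Page) (i₁ : ι), mult V' = mult V ∧ Defect cl V' δ i₁ (j + 1) ∧
      evictCost (fun q => (1 / 2 : ℝ) ^ cl q) V V' ≤ (1 / 2) ^ j := by
  by_cases hb : ∀ i i', level cl V (j + 1) i ≤ level cl V (j + 1) i' + 1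
  · refine ⟨V, i₀, rfl, ⟨fun j' hj' => ?_, fun j' hj' => h.2 j' (by omega)⟩, ?_⟩
    · rcases Nat.le_succ_iff.1 hj' with hj' | rfl
      · exact h.1 j' hj'
      · exact hb
    · simp [evictCost]
  push Not at hb
  obtain ⟨a, b, hab⟩ := hb
  obtain ⟨V', hm, hlow, hhigh, hc⟩ := exists_move cl V j a b (h.1 j le_rfl a b) (by omega)
  have h1 := h.2 (j + 1) (by omega)
  have hne : a ≠ b := by rintro rfl; omega
  have habs := h1 a b
  -- The corrected counts differ by at most one, the true ones by two: the correction acts on the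
  -- poor lane `b` if it is positive, and on the rich lane `a` if it is negative.
  have key : (δ = 1 ∧ b = i₀ ∧ a ≠ i₀) ∨ (δ = -1 ∧ a = i₀ ∧ b ≠ i₀) := by
    rcases hδ with rfl | rfl <;> split_ifs at habs <;> simp_all <;> omega
  have hA : ∀ i, (i = a ∧ (if i = a then (1 : ℤ) else 0) = 1 ∧ (if i = b then (1 : ℤ) else 0) = 0) ∨
      (i = b ∧ (if i = a then (1 : ℤ) else 0) = 0 ∧ (if i = b then (1 : ℤ) else 0) = 1) ∨
      ((if i = a then (1 : ℤ) else 0) = 0 ∧ (if i = b then (1 : ℤ) else 0) = 0) := by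
    intro i
    by_cases hia : i = a
    · subst hia; simp [hne]
    · by_cases hib : i = b
      · subst hib; simp [hia]
      · simp [hia, hib]
  have hneg : ∀ i c : ι, (if i = c then (-1 : ℤ) else 0) = -(if i = c then 1 else 0) := by
    intro i c; split_ifs <;> rfl
  have hbal : ∃ m : ℤ, ∀ i, m ≤ level cl V' (j + 1) i ∧ (level cl V' (j + 1) i : ℤ) ≤ m + 1 := by
    rcases key with ⟨rfl, rfl, hn⟩ | ⟨rfl, rfl, hn⟩
    · refine ⟨level cl V (j + 1) b + 1, fun i => ?_⟩
      have e := hhigh (j + 1) (by omega) i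
      have p1 := h1 i b
      have p2 := h1 a i
      simp only [if_true, hne, if_false] at p1 p2 habs
      rcases hA i with ⟨rfl, h3, h4⟩ | ⟨rfl, h3, h4⟩ | ⟨h3, h4⟩ <;>
        rw [h3, h4] at e <;> rw [h4] at p1 p2 <;> constructor <;> linarith
    · refine ⟨level cl V (j + 1) b, fun i => ?_⟩
      have e := hhigh (j + 1) (by omega) i
      have p1 := h1 i b
      have p2 := h1 a i
      simp only [if_true, hne.symm, if_false, hneg] at p1 p2 habs
      have hab' : (level cl V (j + 1) b : ℤ) + 1 < level cl V (j + 1) a := by exact_mod_cast hab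
      rcases hA i with ⟨rfl, h3, h4⟩ | ⟨rfl, h3, h4⟩ | ⟨h3, h4⟩ <;>
        rw [h3, h4] at e <;> rw [h3] at p1 p2 <;> constructor <;> linarith
  refine ⟨V', if δ = 1 then a else b, hm, ⟨fun j' hj' i i' => ?_, fun j' hj' i i' => ?_⟩, hc⟩
  · rcases Nat.le_succ_iff.1 hj' with hj' | rfl
    · rw [hlow j' hj', hlow j' hj']; exact h.1 j' hj' i i'
    · obtain ⟨m, hm⟩ := hbal
      have := (hm i).2
      have := (hm i').1
      show level cl V' (j + 1) i ≤ level cl V' (j + 1) i' + 1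
      omega
  · have e1 := hhigh j' (by omega) i
    have e2 := hhigh j' (by omega) i'
    have p5 := h.2 j' (by omega) i i'
    rw [e1, e2]
    rcases key with ⟨rfl, rfl, hn⟩ | ⟨rfl, rfl, hn⟩
    · simp only [if_true]; linarith
    · simp only [show ¬ ((-1 : ℤ) = 1) by norm_num, if_false, hneg] at p5 ⊢
      linarith

/-- The bound is the geometric sum of the step costs, kept in closed form so that it telescopes. -/
lemma Defect.iterate {cl : Page → ℕ} {V : ι → Finset Page} {δ : ℤ} (hδ : δ = 1 ∨ δ = -1) {i₀ : ι}
    {j : ℕ} (h : Defect cl V δ i₀ j) (d : ℕ) :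
    ∃ (V' : ι → Finset Page) (i₁ : ι), mult V' = mult V ∧ Defect cl V' δ i₁ (j + d) ∧
      evictCost (fun q => (1 / 2 : ℝ) ^ cl q) V V' ≤ 2 * (1 / 2) ^ j - 2 * (1 / 2) ^ (j + d) := by
  induction d with
  | zero => exact ⟨V, i₀, rfl, h, by simp [evictCost]⟩
  | succ d ih =>
    obtain ⟨V', i₁, hm, hd, hc⟩ := ih
    obtain ⟨W, i₂, hm', hd', hc'⟩ := hd.step hδ
    refine ⟨W, i₂, hm'.trans hm, hd', ?_⟩
    have := evictCost_triangle (w := fun q => (1 / 2 : ℝ) ^ cl q) (fun q => by positivity) V V' W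
    have e : (1 / 2 : ℝ) ^ (j + (d + 1)) = (1 / 2) ^ (j + d) / 2 := by
      rw [← add_assoc, pow_succ]; ring
    rw [e]
    linarith

lemma Defect.repair {cl : Page → ℕ} {J : ℕ} (hJ : ∀ q, cl q ≤ J) {V : ι → Finset Page} {δ : ℤ}
    (hδ : δ = 1 ∨ δ = -1) {i₀ : ι} {j : ℕ} (h : Defect cl V δ i₀ j) :
    ∃ V' : ι → Finset Page, mult V' = mult V ∧ Balanced cl V' ∧
      evictCost (fun q => (1 / 2 : ℝ) ^ cl q) V V' ≤ 2 * (1 / 2) ^ j := by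
  -- After `J + 1` steps the defect has passed the last class, and all longer prefixes count the
  -- same pages.
  obtain ⟨V', i₁, hm, hd, hc⟩ := h.iterate hδ (J + 1)
  refine ⟨V', hm, fun j' i i' => ?_, hc.trans (by simp)⟩
  by_cases hj' : j' ≤ j + (J + 1)
  · exact hd.1 j' hj' i i'
  · have : ∀ i, level cl V' j' i = level cl V' (j + (J + 1)) i := by
      intro i
      unfold level
      congr 1
      ext q
      have := hJ q
      simp only [Finset.mem_filter, and_congr_right_iff]
      intro _
      constructor <;> intro <;> omega
    rw [this, this]
    exact hd.1 _ le_rfl i i'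

/-- Deleting `q` from any lane that holds it leaves a defect `+1` there, beyond prefix `cl q`. The
factor 3 is one unit for the deletion and two for the cascade. -/
lemma exists_balanced_remove {cl : Page → ℕ} {J : ℕ} (hJ : ∀ q, cl q ≤ J) {V : ι → Finset Page}
    (hV : Balanced cl V) {q : Page} (hq : 0 < mult V q) :
    ∃ V' : ι → Finset Page, mult V' = Function.update (mult V) q (mult V q - 1) ∧ Balanced cl V' ∧
      evictCost (fun q => (1 / 2 : ℝ) ^ cl q) V V' ≤ 3 * (1 / 2) ^ cl q := by
  obtain ⟨a, ha⟩ := Finset.card_pos.1 hq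
  simp only [Finset.mem_filter, Finset.mem_univ, true_and] at ha
  let V' : ι → Finset Page := fun i => if i = a then (V a).erase q else V i
  have hVa : V' a = (V a).erase q := by simp [V']
  have hVo : ∀ i, i ≠ a → V' i = V i := fun i h => by simp [V', h]
  have hmult : mult V' = Function.update (mult V) q (mult V q - 1) := by
    ext r
    unfold mult
    by_cases hr : r = q
    · subst hr
      rw [Function.update_self, ← Finset.card_erase_of_mem (a := a) (by simpa using ha)]
      congr 1
      ext i
      by_cases hia : i = a
      · subst hia; simp [hVa]
      · simp [hVo i hia, hia]
    · rw [Function.update_of_ne hr]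
      congr 1
      ext i
      by_cases hia : i = a
      · subst hia; simp [hVa, hr]
      · simp [hVo i hia]
  have hlow : ∀ j' ≤ cl q, ∀ i, level cl V' j' i = level cl V j' i := by
    intro j' hj' i
    unfold level
    by_cases hia : i = a
    · subst hia
      rw [hVa, Finset.filter_erase, Finset.erase_eq_of_notMem]
      simp; omega
    · rw [hVo i hia]
  have hhigh : ∀ j', cl q < j' → ∀ i,
      (level cl V' j' i : ℤ) + (if i = a then 1 else 0) = level cl V j' i := by
    intro j' hj' i
    unfold level
    by_cases hia : i = a
    · subst hia
      rw [hVa, Finset.filter_erase, Finset.card_erase_of_mem (by simp [ha]; omega)]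
      have : 0 < ((V i).filter (fun q => cl q < j')).card :=
        Finset.card_pos.2 ⟨q, by simp [ha]; omega⟩
      simp
      omega
    · simp [hVo i hia, hia]
  have hdef : Defect cl V' 1 a (cl q) := by
    refine ⟨fun j' hj' i i' => ?_, fun j' hj' i i' => ?_⟩
    · rw [hlow j' hj', hlow j' hj']; exact hV j' i i'
    · rw [hhigh j' hj', hhigh j' hj']; exact_mod_cast hV j' i i'
  obtain ⟨W, hm, hb, hc⟩ := hdef.repair hJ (Or.inl rfl)
  refine ⟨W, hm.trans hmult, hb, ?_⟩
  have h1 := evictCost_triangle (w := fun q => (1 / 2 : ℝ) ^ cl q) (fun q => by positivity) V V' W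
  have h2 : evictCost (fun q => (1 / 2 : ℝ) ^ cl q) V V' = (1 / 2) ^ cl q := by
    unfold evictCost
    rw [Finset.sum_eq_single a]
    · have : V a \ (V a).erase q = {q} := by
        ext r
        simp only [Finset.mem_sdiff, Finset.mem_erase, Finset.mem_singleton]
        constructor
        · tauto
        · rintro rfl; tauto
      rw [hVa, this]
      simp
    · intro i _ hia
      simp [hVo i hia]
    · simp
  linarith

lemma exists_balanced_insert {cl : Page → ℕ} {J : ℕ} (hJ : ∀ q, cl q ≤ J) {V : ι → Finset Page}
    (hV : Balanced cl V) {q : Page} (hq : mult V q < Fintype.card ι) :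
    ∃ V' : ι → Finset Page, mult V' = Function.update (mult V) q (mult V q + 1) ∧ Balanced cl V' ∧
      evictCost (fun q => (1 / 2 : ℝ) ^ cl q) V V' ≤ 3 * (1 / 2) ^ cl q := by
  obtain ⟨a, ha⟩ : ∃ a, q ∉ V a := by
    by_contra! h
    simp [mult, h] at hq
  let V' : ι → Finset Page := fun i => if i = a then insert q (V a) else V i
  have hVa : V' a = insert q (V a) := by simp [V']
  have hVo : ∀ i, i ≠ a → V' i = V i := fun i h => by simp [V', h]
  have hmult : mult V' = Function.update (mult V) q (mult V q + 1) := by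
    ext r
    unfold mult
    by_cases hr : r = q
    · subst hr
      rw [Function.update_self, ← Finset.card_insert_of_notMem (a := a) (by simpa using ha)]
      congr 1
      ext i
      by_cases hia : i = a
      · subst hia; simp [hVa]
      · simp [hVo i hia, hia]
    · rw [Function.update_of_ne hr]
      congr 1
      ext i
      by_cases hia : i = a
      · subst hia; simp [hVa, hr]
      · simp [hVo i hia]
  have hlow : ∀ j' ≤ cl q, ∀ i, level cl V' j' i = level cl V j' i := by
    intro j' hj' i
    unfold level
    by_cases hia : i = a
    · subst hia
      rw [hVa, Finset.filter_insert, if_neg (by omega)]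
    · rw [hVo i hia]
  have hhigh : ∀ j', cl q < j' → ∀ i,
      (level cl V' j' i : ℤ) + (if i = a then -1 else 0) = level cl V j' i := by
    intro j' hj' i
    unfold level
    by_cases hia : i = a
    · subst hia
      rw [hVa, Finset.filter_insert, if_pos (by omega), Finset.card_insert_of_notMem (by simp [ha])]
      simp
    · simp [hVo i hia, hia]
  have hdef : Defect cl V' (-1) a (cl q) := by
    refine ⟨fun j' hj' i i' => ?_, fun j' hj' i i' => ?_⟩
    · rw [hlow j' hj', hlow j' hj']; exact hV j' i i'
    · rw [hhigh j' hj', hhigh j' hj']; exact_mod_cast hV j' i i'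
  obtain ⟨W, hm, hb, hc⟩ := hdef.repair hJ (Or.inr rfl)
  refine ⟨W, hm.trans hmult, hb, ?_⟩
  have h1 := evictCost_triangle (w := fun q => (1 / 2 : ℝ) ^ cl q) (fun q => by positivity) V V' W
  have h2 : evictCost (fun q => (1 / 2 : ℝ) ^ cl q) V V' = 0 := by
    unfold evictCost
    refine Finset.sum_eq_zero fun i _ => ?_
    by_cases hia : i = a
    · subst hia; simp [hVa, Finset.sdiff_eq_empty_iff_subset.2 (Finset.subset_insert q (V i))]
    · simp [hVo i hia]
  have : (0 : ℝ) < (1 / 2) ^ cl q := by positivity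
  linarith

/-- Balanced lanes can be moved to any prescribed multiplicities, at a cost proportional to the
weighted change of the multiplicities. -/
theorem exists_rebalanced {cl : Page → ℕ} {J : ℕ} (hJ : ∀ q, cl q ≤ J) {V : ι → Finset Page}
    (hV : Balanced cl V) (P : Finset Page) (b : Page → ℕ) (hb : ∀ q, b q ≤ Fintype.card ι)
    (hP : ∀ q ∉ P, b q = mult V q) :
    ∃ V' : ι → Finset Page, mult V' = b ∧ Balanced cl V' ∧
      evictCost (fun q => (1 / 2 : ℝ) ^ cl q) V V' ≤
        3 * ∑ q ∈ P, (1 / 2 : ℝ) ^ cl q * |(b q : ℝ) - mult V q| := by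
  -- With truncated subtraction each summand is the absolute difference; each unit change of a
  -- multiplicity lowers this distance.
  obtain ⟨d, hd⟩ : ∃ d, d = ∑ q ∈ P, ((b q - mult V q) + (mult V q - b q)) := ⟨_, rfl⟩
  induction d using Nat.strong_induction_on generalizing V with
  | _ d ih =>
  by_cases hall : ∀ q ∈ P, b q = mult V q
  · have : mult V = b := by
      ext q
      by_cases hq : q ∈ P
      · exact (hall q hq).symm
      · exact (hP q hq).symm
    refine ⟨V, this, hV, ?_⟩
    rw [this]
    simp [evictCost]
  · push Not at hall
    obtain ⟨q, hqP, hq⟩ := hall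
    obtain ⟨W, a, hm, hWb, hWc, hlt, habs⟩ : ∃ (W : ι → Finset Page) (a : ℕ),
        mult W = Function.update (mult V) q a ∧ Balanced cl W ∧
        evictCost (fun q => (1 / 2 : ℝ) ^ cl q) V W ≤ 3 * (1 / 2) ^ cl q ∧
        (b q - a) + (a - b q) < (b q - mult V q) + (mult V q - b q) ∧
        |(b q : ℝ) - a| = |(b q : ℝ) - mult V q| - 1 := by
      rcases Nat.lt_or_ge (b q) (mult V q) with h | h
      · obtain ⟨W, h1, h2, h3⟩ := exists_balanced_remove hJ hV (q := q) (by omega)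
        refine ⟨W, _, h1, h2, h3, by omega, ?_⟩
        have h' : (b q : ℝ) ≤ mult V q - 1 := by
          have : b q + 1 ≤ mult V q := h
          have : (b q : ℝ) + 1 ≤ mult V q := by exact_mod_cast this
          linarith
        rw [Nat.cast_sub (by omega), Nat.cast_one, abs_of_nonpos (by linarith),
          abs_of_nonpos (by linarith)]
        ring
      · have h : mult V q < b q := lt_of_le_of_ne h (Ne.symm hq)
        obtain ⟨W, h1, h2, h3⟩ := exists_balanced_insert hJ hV (q := q) (h.trans_le (hb q))
        refine ⟨W, _, h1, h2, h3, by omega, ?_⟩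
        have h' : (mult V q : ℝ) + 1 ≤ b q := by exact_mod_cast h
        rw [Nat.cast_add, Nat.cast_one, abs_of_nonneg (by linarith), abs_of_nonneg (by linarith)]
        ring
    have hmq : mult W q = a := by rw [hm, Function.update_self]
    have hmo : ∀ r, r ≠ q → mult W r = mult V r := fun r hr => by
      rw [hm, Function.update_of_ne hr]
    obtain ⟨V', h1, h2, h3⟩ := ih _ (by
      rw [hd]
      refine Finset.sum_lt_sum (fun r _ => ?_) ⟨q, hqP, ?_⟩
      · by_cases hr : r = q
        · subst hr; rw [hmq]; exact hlt.le
        · rw [hmo r hr]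
      · rw [hmq]; exact hlt) hWb (fun r hr => by
        rw [hmo r (by rintro rfl; exact hr hqP)]; exact hP r hr) rfl
    refine ⟨V', h1, h2, ?_⟩
    have h4 := evictCost_triangle (w := fun q => (1 / 2 : ℝ) ^ cl q) (fun q => by positivity) V W V'
    have h5 : ∑ r ∈ P, (1 / 2 : ℝ) ^ cl r * |(b r : ℝ) - mult V r|
        = ∑ r ∈ P, (1 / 2 : ℝ) ^ cl r * |(b r : ℝ) - mult W r| + (1 / 2) ^ cl q := by
      rw [← Finset.add_sum_erase _ _ hqP, ← Finset.add_sum_erase _ _ hqP, hmq, habs,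
        Finset.sum_congr rfl (g := fun r => (1 / 2 : ℝ) ^ cl r * |(b r : ℝ) - mult W r|)
          (fun r hr => by rw [hmo r (Finset.ne_of_mem_erase hr)])]
      ring
    rw [h5]
    linarith

end Lanes

/-! ### Growth of the missing fractions, paid by a logarithmic potential -/

section Growth

variable {Page : Type} [DecidableEq Page]

lemma half_le_log_one_add {x : ℝ} (h0 : 0 ≤ x) (h1 : x ≤ 1) : x / 2 ≤ Real.log (1 + x) := by
  have h := Real.one_sub_inv_le_log_of_pos (show 0 < 1 + x by linarith)
  refine le_trans ?_ h
  have : (1 + x)⁻¹ ≤ 1 - x / 2 := by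
    rw [inv_le_iff_one_le_mul₀ (by linarith)]
    nlinarith
  linarith

/-- A discrete Euler step of `y' = (y + 1/k) / w` on the set `A` of pages with `y < 1`. Its cost is
`η (∑ y + |A|/k)`, at most `2η(|A| - k + 1)` when the cache is overfull. Each of the at least `|A| -
k + 1` pages of `A` outside `L` gains at least `η/2` in the potential, which gives the factor 4. A
step may overshoot 1, hence the range up to 2. -/
lemma growth_step {k : ℕ} (hk : 1 ≤ k) (s : Finset Page) {w : Page → ℝ} {η : ℝ} (hη : 0 < η)
    (hw : ∀ q, 2 * η ≤ w q) {y : Page → ℝ} (hy : ∀ q, 0 ≤ y q ∧ y q ≤ 2)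
    (hfull : (k : ℝ) - 1 < ∑ q ∈ s, max 0 (1 - y q)) :
    ∃ y' : Page → ℝ, (∀ q, y q ≤ y' q ∧ y' q ≤ 2) ∧ (∀ q ∉ s, y' q = y q) ∧
      (∃ q ∈ s, y q + η / k / w q ≤ y' q) ∧
      ∀ L : Finset Page, (L ∩ s).card + 1 ≤ k →
        ∑ q ∈ s, w q * (y' q - y q) ≤
          4 * ∑ q ∈ s \ L, w q * (Real.log (y' q + 1 / k) - Real.log (y q + 1 / k)) := by
  have hk0 : (1 : ℝ) ≤ k := by exact_mod_cast hk
  have hk1 : 0 < (1 : ℝ) / k := by positivity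
  have hk2 : (1 : ℝ) / k ≤ 1 := by rw [div_le_one (by linarith)]; exact hk0
  have hwpos : ∀ q, 0 < w q := fun q => by have := hw q; linarith
  let A := s.filter (fun q => y q < 1)
  have hAs : A ⊆ s := Finset.filter_subset _ _
  have hA1 : ∀ q ∈ A, y q < 1 := fun q hq => (Finset.mem_filter.1 hq).2
  have hsum : ∑ q ∈ s, max 0 (1 - y q) = ∑ q ∈ A, (1 - y q) := by
    rw [Finset.sum_filter]
    refine Finset.sum_congr rfl fun q _ => ?_
    split_ifs with h
    · exact max_eq_right (by linarith)
    · exact max_eq_left (by linarith)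
  have hsum' : ∑ q ∈ A, (1 - y q) = A.card - ∑ q ∈ A, y q := by simp
  have hAy : ∑ q ∈ A, y q < A.card - (k - 1) := by linarith
  have hAy0 : 0 ≤ ∑ q ∈ A, y q := Finset.sum_nonneg fun q _ => (hy q).1
  have hAk : k ≤ A.card := by
    have : (k : ℝ) - 1 < A.card := by linarith
    have : (k : ℝ) < A.card + 1 := by linarith
    have : k < A.card + 1 := by exact_mod_cast this
    omega
  have hAk' : (k : ℝ) ≤ A.card := by exact_mod_cast hAk
  let y' : Page → ℝ := fun q => if q ∈ A then y q + η * (y q + 1 / k) / w q else y q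
  have hyA : ∀ q ∈ A, y' q = y q + η * (y q + 1 / k) / w q := fun q h => by simp [y', h]
  have hyN : ∀ q ∉ A, y' q = y q := fun q h => by simp [y', h]
  have hle : ∀ q, y q ≤ y' q ∧ y' q ≤ 2 := by
    intro q
    by_cases h : q ∈ A
    · rw [hyA q h]
      have h0 := (hy q).1
      have h1 := hA1 q h
      have : η * (y q + 1 / k) / w q ≤ 1 := by
        rw [div_le_one (hwpos q)]
        have := hw q
        nlinarith
      have : 0 ≤ η * (y q + 1 / k) / w q := by
        have := hwpos q
        positivity
      constructor <;> linarith
    · rw [hyN q h]; exact ⟨le_rfl, (hy q).2⟩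
  refine ⟨y', hle, fun q hq => hyN q fun h => hq (hAs h), ?_, fun L hL => ?_⟩
  · obtain ⟨q, hq⟩ : A.Nonempty := Finset.card_pos.1 (by omega)
    refine ⟨q, hAs hq, ?_⟩
    rw [hyA q hq]
    have := (hy q).1
    have hw' := hwpos q
    have : η / k / w q ≤ η * (y q + 1 / k) / w q := by
      gcongr
      rw [div_eq_mul_one_div]
      gcongr
      linarith
    linarith
  · have e1 : ∑ q ∈ s, w q * (y' q - y q) = η * (∑ q ∈ A, y q + A.card * (1 / k)) := by
      rw [← Finset.sum_subset hAs]
      · have : ∑ q ∈ A, (y q + 1 / (k : ℝ)) = ∑ q ∈ A, y q + A.card * (1 / k) := by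
          rw [Finset.sum_add_distrib]; simp
        rw [← this, Finset.mul_sum]
        refine Finset.sum_congr rfl fun q hq => ?_
        rw [hyA q hq]
        have := (hwpos q).ne'
        field_simp
        ring
      · intro q _ hq
        rw [hyN q hq]; ring
    have e2 : ∑ q ∈ A \ L, η / 2 ≤
        ∑ q ∈ s \ L, w q * (Real.log (y' q + 1 / k) - Real.log (y q + 1 / k)) := by
      refine le_trans (Finset.sum_le_sum (f := fun _ => η / 2) (g := fun q =>
        w q * (Real.log (y' q + 1 / k) - Real.log (y q + 1 / k))) fun q hq => ?_)
        (Finset.sum_le_sum_of_subset_of_nonneg (Finset.sdiff_subset_sdiff hAs le_rfl)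
          fun q _ _ => ?_)
      · have hqA := (Finset.mem_sdiff.1 hq).1
        have h0 := (hy q).1
        have hw' := hwpos q
        have hpos : 0 < y q + 1 / k := by linarith
        have : y' q + 1 / k = (y q + 1 / k) * (1 + η / w q) := by
          rw [hyA q hqA]; ring
        rw [this, Real.log_mul hpos.ne' (by positivity), add_sub_cancel_left]
        have h2 : η / w q ≤ 1 := by
          rw [div_le_one hw']; have := hw q; linarith
        have := half_le_log_one_add (by positivity) h2
        calc η / 2 = w q * (η / w q / 2) := by field_simp
          _ ≤ _ := by gcongr
      · have h0 := (hy q).1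
        refine mul_nonneg (hwpos q).le (sub_nonneg.2 (Real.log_le_log (by linarith) ?_))
        linarith [(hle q).1]
    have e3 : (A.card : ℝ) - (k - 1) ≤ (A \ L).card := by
      have h1 := Finset.card_sdiff_add_card_inter A L
      have h2 : (A ∩ L).card ≤ (L ∩ s).card := by
        refine Finset.card_le_card fun q hq => ?_
        have := Finset.mem_inter.1 hq
        exact Finset.mem_inter.2 ⟨this.2, hAs this.1⟩
      have : A.card + 1 ≤ (A \ L).card + k := by omega
      have : (A.card : ℝ) + 1 ≤ (A \ L).card + k := by exact_mod_cast this
      linarith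
    -- This is equivalent to `k (k - 1) ≤ (k - 1) |A|`, and overfullness forces `|A| ≥ k`.
    have e4 : (A.card : ℝ) * (1 / k) ≤ A.card - (k - 1) := by
      rw [mul_one_div, div_le_iff₀ (by linarith)]
      nlinarith
    rw [e1]
    rw [Finset.sum_const, nsmul_eq_mul] at e2
    nlinarith

/-- The missing fractions of the pages in `s` can be raised until at most `k - 1` units of these
pages remain, at a cost which is paid by the logarithmic potential of every competitor that holds
at most `k - 1` of them. -/
theorem exists_growth {k : ℕ} (hk : 1 ≤ k) (s : Finset Page) {w : Page → ℝ} {ε : ℝ} (hε : 0 < ε)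
    (hw : ∀ q, ε ≤ w q) (hw1 : ∀ q, w q ≤ 1) {y : Page → ℝ} (hy : ∀ q, 0 ≤ y q ∧ y q ≤ 2) :
    ∃ y' : Page → ℝ, (∀ q, y q ≤ y' q ∧ y' q ≤ 2) ∧ (∀ q ∉ s, y' q = y q) ∧
      ∑ q ∈ s, max 0 (1 - y' q) ≤ (k : ℝ) - 1 ∧
      ∀ L : Finset Page, (L ∩ s).card + 1 ≤ k →
        ∑ q ∈ s, w q * (y' q - y q) ≤
          4 * ∑ q ∈ s \ L, w q * (Real.log (y' q + 1 / k) - Real.log (y q + 1 / k)) := by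
  have hk0 : (1 : ℝ) ≤ k := by exact_mod_cast hk
  set δ : ℝ := ε / 2 / k with hδ
  have hδ0 : 0 < δ := by positivity
  -- Termination: every Euler step raises some fraction by at least `δ`, and no fraction exceeds 2.
  -- The lower bound `ε` on the weights permits a uniform step size.
  obtain ⟨r, hr⟩ : ∃ r : ℕ, ∑ q ∈ s, (2 - y q) ≤ r * δ := by
    obtain ⟨r, hr⟩ := exists_nat_ge ((∑ q ∈ s, (2 - y q)) / δ)
    exact ⟨r, by rwa [div_le_iff₀ hδ0] at hr⟩
  induction r generalizing y with
  | zero =>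
    refine ⟨y, fun q => ⟨le_rfl, (hy q).2⟩, fun _ _ => rfl, ?_, fun L _ => by simp⟩
    have h0 : ∀ q ∈ s, 0 ≤ 2 - y q := fun q _ => by linarith [(hy q).2]
    have h1 : ∑ q ∈ s, (2 - y q) = 0 := le_antisymm (by simpa using hr) (Finset.sum_nonneg h0)
    have h2 := (Finset.sum_eq_zero_iff_of_nonneg h0).1 h1
    rw [Finset.sum_eq_zero fun q hq => max_eq_left (by linarith [h2 q hq])]
    linarith
  | succ r ih =>
    by_cases hfull : ∑ q ∈ s, max 0 (1 - y q) ≤ (k : ℝ) - 1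
    · exact ⟨y, fun q => ⟨le_rfl, (hy q).2⟩, fun _ _ => rfl, hfull, fun L _ => by simp⟩
    obtain ⟨y₁, h1, h2, ⟨q, hqs, hq⟩, h4⟩ := growth_step hk s (w := w) (η := ε / 2) (by positivity)
      (fun q => by linarith [hw q]) hy (not_le.1 hfull)
    obtain ⟨y₂, g1, g2, g3, g4⟩ := ih (y := y₁)
      (fun q => ⟨(hy q).1.trans (h1 q).1, (h1 q).2⟩) (by
        have hwq : 0 < w q := hε.trans_le (hw q)
        have : δ ≤ δ / w q := by
          rw [le_div_iff₀ hwq]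
          nlinarith [hw1 q]
        have hle : ∑ q ∈ s, (2 - y₁ q) ≤ ∑ q ∈ s, (2 - y q) - δ := by
          rw [← Finset.add_sum_erase _ _ hqs, ← Finset.add_sum_erase _ _ hqs]
          have := Finset.sum_le_sum (s := s.erase q) (f := fun q => 2 - y₁ q)
            (g := fun q => 2 - y q) fun q _ => by linarith [(h1 q).1]
          linarith
        push_cast at hr
        linarith)
    refine ⟨y₂, fun q => ⟨(h1 q).1.trans (g1 q).1, (g1 q).2⟩,
      fun q hq => (g2 q hq).trans (h2 q hq), g3, fun L hL => ?_⟩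
    have a := h4 L hL
    have b := g4 L hL
    have e1 : ∑ q ∈ s, w q * (y₂ q - y q)
        = ∑ q ∈ s, w q * (y₂ q - y₁ q) + ∑ q ∈ s, w q * (y₁ q - y q) := by
      rw [← Finset.sum_add_distrib]
      exact Finset.sum_congr rfl fun q _ => by ring
    have e2 : ∑ q ∈ s \ L, w q * (Real.log (y₂ q + 1 / k) - Real.log (y q + 1 / k))
        = ∑ q ∈ s \ L, w q * (Real.log (y₂ q + 1 / k) - Real.log (y₁ q + 1 / k))
          + ∑ q ∈ s \ L, w q * (Real.log (y₁ q + 1 / k) - Real.log (y q + 1 / k)) := by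
      rw [← Finset.sum_add_distrib]
      exact Finset.sum_congr rfl fun q _ => by ring
    rw [e1, e2]
    linarith

end Growth

/-! ### The joint simulation of all lanes and its invariants -/

/-- The state of the joint simulation of all `T + 1` lanes: the missing fraction of every page, the
virtual lanes, the lazy lanes which the algorithm really runs, the number of evictions of every page
(over all lazy lanes), and the number and the sum of the samples of every page used so far. -/
structure LaneState (Page : Type) (T : ℕ) where
  y : Page → ℝ
  V : Fin (T + 1) → Finset Page
  R : Fin (T + 1) → Finset Page
  D : Page → ℕ
  m : Page → ℕ
  s : Page → ℕ

/-- The condition under which `m` samples of (scaled) sum `s` are considered compatible with the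
weight `2⁻ᶜ`. -/
def Plausible (T m s c : ℕ) : Prop :=
  (s : ℝ) / (T + 1) ≤ 4 * m * (1 / 2) ^ c + (3 * Real.log T + 1)

/-- The weight class of a page: the smallest plausible weight is `2` to the minus this power. -/
noncomputable def weightClass (T m s : ℕ) : ℕ :=
  @Nat.findGreatest (Plausible T m s) (Classical.decPred _) T

lemma weightClass_le (T m s : ℕ) : weightClass T m s ≤ T :=
  @Nat.findGreatest_le _ (Classical.decPred _) T

/-- The number of lanes, out of `N`, that hold a page of missing fraction `y`. -/
noncomputable def laneCount (N : ℕ) (y : ℝ) : ℕ := N - ⌈N * y⌉₊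

lemma laneCount_le (N : ℕ) (y : ℝ) : laneCount N y ≤ N := Nat.sub_le _ _

lemma laneCount_zero (N : ℕ) : laneCount N 0 = N := by simp [laneCount]

lemma laneCount_one (N : ℕ) : laneCount N 1 = 0 := by simp [laneCount]

lemma laneCount_anti (N : ℕ) {y z : ℝ} (h : y ≤ z) : laneCount N z ≤ laneCount N y := by
  unfold laneCount
  have : ⌈N * y⌉₊ ≤ ⌈N * z⌉₊ := Nat.ceil_mono (by gcongr)
  omega

lemma laneCount_le_mul (N : ℕ) (y : ℝ) : (laneCount N y : ℝ) ≤ N * max 0 (1 - y) := by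
  unfold laneCount
  rcases le_total N ⌈N * y⌉₊ with h | h
  · rw [Nat.sub_eq_zero_of_le h, Nat.cast_zero]
    positivity
  · rw [Nat.cast_sub h]
    have := Nat.le_ceil (N * y)
    have : (N : ℝ) * (1 - y) ≤ N * max 0 (1 - y) := by gcongr; exact le_max_right _ _
    linarith

lemma le_laneCount (N : ℕ) {y : ℝ} (hy : 0 ≤ y) : (N : ℝ) - N * y - 1 ≤ laneCount N y := by
  unfold laneCount
  have h1 := Nat.ceil_lt_add_one (show 0 ≤ N * y by positivity)
  have h2 : (N : ℝ) ≤ (N - ⌈N * y⌉₊ : ℕ) + ⌈N * y⌉₊ := by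
    have : N ≤ (N - ⌈N * y⌉₊) + ⌈N * y⌉₊ := by omega
    exact_mod_cast this
  linarith

section

variable {Page : Type} [DecidableEq Page]

/-- The specification of the growth of the missing fractions of the pages in `s`. -/
def GrowthSpec (k : ℕ) (s : Finset Page) (w y y' : Page → ℝ) : Prop :=
  (∀ q, y q ≤ y' q ∧ y' q ≤ 2) ∧ (∀ q ∉ s, y' q = y q) ∧
    ∑ q ∈ s, max 0 (1 - y' q) ≤ (k : ℝ) - 1 ∧
    ∀ L : Finset Page, (L ∩ s).card + 1 ≤ k →
      ∑ q ∈ s, w q * (y' q - y q) ≤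
        4 * ∑ q ∈ s \ L, w q * (Real.log (y' q + 1 / k) - Real.log (y q + 1 / k))

/-- The specification of the rebalancing of the lanes. -/
def RebalanceSpec {T : ℕ} (S : Finset Page) (cl : Page → ℕ) (V : Fin (T + 1) → Finset Page)
    (y' : Page → ℝ) (V' : Fin (T + 1) → Finset Page) : Prop :=
  mult V' = (fun q => laneCount (T + 1) (y' q)) ∧ Balanced cl V' ∧
    evictCost (fun q => (1 / 2 : ℝ) ^ cl q) V V' ≤
      3 * ∑ q ∈ S, (1 / 2 : ℝ) ^ cl q * |(laneCount (T + 1) (y' q) : ℝ) - mult V q|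

namespace LaneState

variable {T : ℕ}

/-- The initial state: empty lanes, all pages missing. -/
def init (Page : Type) (T : ℕ) : LaneState Page T where
  y _ := 1
  V _ := ∅
  R _ := ∅
  D _ := 0
  m _ := 0
  s _ := 0

/-- The current weight class of a page. -/
noncomputable def cl (σ : LaneState Page T) (q : Page) : ℕ := weightClass T (σ.m q) (σ.s q)

/-- The current optimistic estimate of the weight of a page. -/
noncomputable def wt (σ : LaneState Page T) (q : Page) : ℝ := (1 / 2) ^ σ.cl q

/-- The missing fractions after serving page `p`, where `S` is the set of pages seen so far. -/
noncomputable def nextY (k : ℕ) (S : Finset Page) (p : Page) (σ : LaneState Page T) : Page → ℝ :=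
  Classical.epsilon (GrowthSpec k (S.erase p) σ.wt (Function.update σ.y p 0))

/-- The virtual lanes after serving page `p`. -/
noncomputable def nextV (k : ℕ) (S : Finset Page) (p : Page) (σ : LaneState Page T) :
    Fin (T + 1) → Finset Page :=
  Classical.epsilon (RebalanceSpec S σ.cl σ.V (σ.nextY k S p))

/-- The lazy lanes after serving page `p`: they fetch only the requested page. -/
noncomputable def nextR (k : ℕ) (S : Finset Page) (p : Page) (σ : LaneState Page T) :
    Fin (T + 1) → Finset Page :=
  fun i => insert p (σ.R i ∩ σ.nextV k S p i)

/-- The number of lazy lanes from which page `q` is evicted when page `p` is served. -/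
noncomputable def evictions (k : ℕ) (S : Finset Page) (p : Page) (σ : LaneState Page T)
    (q : Page) : ℕ :=
  (Finset.univ.filter (fun i => q ∈ σ.R i \ σ.nextR k S p i)).card

/-- A fresh sample of page `p` is due. -/
def Due (p : Page) (σ : LaneState Page T) : Prop := (σ.m p + 1) * (T + 1) ≤ σ.D p

instance (p : Page) (σ : LaneState Page T) : Decidable (σ.Due p) :=
  inferInstanceAs (Decidable (_ ≤ _))

/-- The state after serving page `p`, where `x` is the next sample of `p`, used only if due. -/
noncomputable def round (k : ℕ) (S : Finset Page) (p : Page) (x : ℕ) (σ : LaneState Page T) :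
    LaneState Page T where
  y := σ.nextY k S p
  V := σ.nextV k S p
  R := σ.nextR k S p
  D q := σ.D q + σ.evictions k S p q
  m := if σ.Due p then Function.update σ.m p (σ.m p + 1) else σ.m
  s := if σ.Due p then Function.update σ.s p (σ.s p + x) else σ.s

/-- The state after the requests in the list (latest first), for a given table of samples. -/
noncomputable def after (k T : ℕ) (Y : Page → ℕ → ℕ) : List Page → LaneState Page T
  | [] => init Page T
  | p :: l => (after k T Y l).round k (p :: l).toFinset p (Y p ((after k T Y l).m p))

lemma m_le_round (k : ℕ) (S : Finset Page) (p : Page) (x : ℕ) (σ : LaneState Page T) (q : Page) :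
    σ.m q ≤ (σ.round k S p x).m q := by
  simp only [round]
  split_ifs
  · by_cases h : q = p
    · subst h; simp
    · simp [h]
  · rfl

/-- The state depends only on the samples it has used. -/
lemma after_congr (k : ℕ) (Y Y' : Page → ℕ → ℕ) (l : List Page)
    (h : ∀ q, ∀ j < (after k T Y l).m q, Y q j = Y' q j) :
    after k T Y l = after k T Y' l := by
  induction l with
  | nil => rfl
  | cons p l ih =>
    have e := ih fun q j hj => h q j (hj.trans_le (m_le_round _ _ _ _ _ _))
    rw [after, after, ← e]
    by_cases hd : (after k T Y l).Due p
    · rw [h p]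
      simp [after, round, hd]
    · simp [round, hd]

/-- The invariants of the simulation. -/
structure Inv (k : ℕ) (l : List Page) (σ : LaneState Page T) : Prop where
  y_mem : ∀ q, 0 ≤ σ.y q ∧ σ.y q ≤ 2
  y_unseen : ∀ q ∉ l, σ.y q = 1
  balanced : Balanced σ.cl σ.V
  mult_V : ∀ q, mult σ.V q = laneCount (T + 1) (σ.y q)
  card_V : ∀ i, (σ.V i).card ≤ k
  R_sub : ∀ i, σ.R i ⊆ σ.V i
  m_le : ∀ q, σ.m q * (T + 1) ≤ σ.D q
  D_le : ∀ q, σ.D q + mult σ.R q ≤ (σ.m q + 2) * (T + 1)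
  D_le_count : ∀ q, σ.D q + mult σ.R q ≤ l.count q * (T + 1)

omit [DecidableEq Page] in
lemma wt_pos (σ : LaneState Page T) (q : Page) : 0 < σ.wt q := by unfold wt; positivity

omit [DecidableEq Page] in
lemma wt_le_one (σ : LaneState Page T) (q : Page) : σ.wt q ≤ 1 :=
  pow_le_one₀ (by norm_num) (by norm_num)

lemma nextY_spec {k : ℕ} (hk : 1 ≤ k) {l : List Page} {σ : LaneState Page T} (h : σ.Inv k l)
    (S : Finset Page) (p : Page) :
    GrowthSpec k (S.erase p) σ.wt (Function.update σ.y p 0) (σ.nextY k S p) := by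
  refine Classical.epsilon_spec (p := GrowthSpec k (S.erase p) σ.wt (Function.update σ.y p 0)) ?_
  -- Classes are capped at `T`, so the estimates stay at least `2⁻ᵀ`.
  refine exists_growth hk _ (ε := (1 / 2) ^ T) (by positivity) (fun q => ?_) σ.wt_le_one fun q => ?_
  · exact pow_le_pow_of_le_one (by norm_num) (by norm_num) (weightClass_le _ _ _)
  · by_cases hq : q = p
    · subst hq; simp
    · simpa [hq] using h.y_mem q

lemma nextY_self {k : ℕ} (hk : 1 ≤ k) {l : List Page} {σ : LaneState Page T} (h : σ.Inv k l)
    (S : Finset Page) (p : Page) : σ.nextY k S p p = 0 := by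
  rw [(nextY_spec hk h S p).2.1 p (by simp)]
  simp

lemma nextY_unseen {k : ℕ} (hk : 1 ≤ k) {l : List Page} {σ : LaneState Page T} (h : σ.Inv k l)
    (S : Finset Page) (p : Page) {q : Page} (hq : q ∉ S) (hqp : q ≠ p) :
    σ.nextY k S p q = σ.y q := by
  rw [(nextY_spec hk h S p).2.1 q (by simp [hq])]
  simp [hqp]

lemma nextV_spec {k : ℕ} (hk : 1 ≤ k) {l : List Page} {σ : LaneState Page T} (h : σ.Inv k l)
    {S : Finset Page} {p : Page} (hp : p ∈ S) :
    RebalanceSpec S σ.cl σ.V (σ.nextY k S p) (σ.nextV k S p) := by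
  refine Classical.epsilon_spec (p := RebalanceSpec S σ.cl σ.V (σ.nextY k S p)) ?_
  refine exists_rebalanced (J := T) (fun q => weightClass_le _ _ _) h.balanced S _
    (fun q => ?_) fun q hq => ?_
  · simpa using laneCount_le _ _
  · rw [h.mult_V, nextY_unseen hk h S p hq (by rintro rfl; exact hq hp)]

lemma mem_nextV_self {k : ℕ} (hk : 1 ≤ k) {l : List Page} {σ : LaneState Page T} (h : σ.Inv k l)
    {S : Finset Page} {p : Page} (hp : p ∈ S) (i : Fin (T + 1)) : p ∈ σ.nextV k S p i := by
  have e := congrFun (nextV_spec hk h hp).1 p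
  simp only [nextY_self hk h, laneCount_zero] at e
  have : Finset.univ.filter (fun i => p ∈ σ.nextV k S p i) = Finset.univ := by
    rw [← Finset.card_eq_iff_eq_univ]
    simpa [mult] using e
  have hi : i ∈ Finset.univ.filter (fun i => p ∈ σ.nextV k S p i) := by rw [this]; simp
  simpa using hi

lemma level_eq_of_mem (cl : Page → ℕ) (V : Fin (T + 1) → Finset Page) (j : ℕ) {i : Fin (T + 1)}
    {p : Page} (h : p ∈ V i) :
    level cl V j i = (((V i).erase p).filter (fun q => cl q < j)).card + if cl p < j then 1 else 0 := by
  unfold level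
  conv_lhs => rw [← Finset.insert_erase h, Finset.filter_insert]
  split_ifs
  · rw [Finset.card_insert_of_notMem (by simp)]
  · rfl

/-- A page that lies in every lane contributes equally to all counts, whatever its class. This is
why an estimate is updated only at a request of its page. -/
lemma _root_.OWPUW.Balanced.change_class {cl cl' : Page → ℕ} {V : Fin (T + 1) → Finset Page}
    (h : Balanced cl V) {p : Page} (hp : ∀ i, p ∈ V i) (hcl : ∀ q ≠ p, cl' q = cl q) :
    Balanced cl' V := by
  intro j i i'
  have e := h j i i'
  rw [level_eq_of_mem _ _ _ (hp i), level_eq_of_mem _ _ _ (hp i')] at e ⊢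
  have : ∀ i, ((V i).erase p).filter (fun q => cl' q < j)
      = ((V i).erase p).filter (fun q => cl q < j) := by
    intro i
    refine Finset.filter_congr fun q hq => ?_
    rw [hcl q (Finset.ne_of_mem_erase hq)]
  rw [this, this]
  omega

lemma round_cl (k : ℕ) (S : Finset Page) (p : Page) (x : ℕ) (σ : LaneState Page T) {q : Page}
    (hq : q ≠ p) : (σ.round k S p x).cl q = σ.cl q := by
  simp only [cl, round]
  split_ifs <;> simp [hq]

lemma sum_card_eq_sum_mult {V : Fin (T + 1) → Finset Page} {S : Finset Page}
    (h : ∀ i, V i ⊆ S) : ∑ i, (V i).card = ∑ q ∈ S, mult V q := by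
  have e : ∀ i, (V i).card = ∑ q ∈ S, if q ∈ V i then 1 else 0 := by
    intro i
    rw [← Finset.sum_filter, Finset.filter_mem_eq_inter, Finset.inter_eq_right.2 (h i)]
    simp
  simp_rw [e]
  rw [Finset.sum_comm]
  refine Finset.sum_congr rfl fun q _ => ?_
  simp [mult]

-- The prefix of all classes makes lane sizes differ by at most one, so an average of at most `k`
-- bounds each of them.
omit [DecidableEq Page] in
lemma _root_.OWPUW.Balanced.card_le {cl : Page → ℕ} {V : Fin (T + 1) → Finset Page}
    (h : Balanced cl V) (hcl : ∀ q, cl q ≤ T) {k : ℕ} (hk : ∑ i, (V i).card ≤ k * (T + 1))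
    (i : Fin (T + 1)) : (V i).card ≤ k := by
  by_contra! hi
  have e : ∀ i, level cl V (T + 1) i = (V i).card := fun i => by
    rw [level, Finset.filter_true_of_mem fun q _ => Nat.lt_succ_of_le (hcl q)]
  have : ∑ _i : Fin (T + 1), k < ∑ i, (V i).card := by
    refine Finset.sum_lt_sum (fun i' _ => ?_) ⟨i, Finset.mem_univ _, hi⟩
    have := h (T + 1) i i'
    rw [e, e] at this
    omega
  simp at this
  nlinarith

lemma Inv.V_sub {k : ℕ} {l : List Page} {σ : LaneState Page T} (h : σ.Inv k l) (i : Fin (T + 1)) :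
    σ.V i ⊆ l.toFinset := by
  intro q hq
  by_contra hn
  have e := h.mult_V q
  rw [h.y_unseen q (by simpa using hn), laneCount_one] at e
  rw [mult, Finset.card_eq_zero] at e
  have : i ∈ Finset.univ.filter (fun i => q ∈ σ.V i) := by simpa using hq
  rw [e] at this
  simp at this

lemma inv_init (k : ℕ) : (init Page T).Inv k [] where
  y_mem q := by norm_num [init]
  y_unseen q _ := rfl
  balanced j i i' := by simp [init, level]
  mult_V q := by simp [init, mult, laneCount_one]
  card_V i := by simp [init]
  R_sub i := by simp [init]
  m_le q := by simp [init]
  D_le q := by simp [init, mult]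
  D_le_count q := by simp [init, mult]

/-- Lazy lanes fetch only the requested page, so for any other page `D q + mult R q` is conserved.
-/
lemma evictions_add_mult (k : ℕ) (S : Finset Page) {p : Page} (σ : LaneState Page T) {q : Page}
    (hq : q ≠ p) : σ.evictions k S p q + mult (σ.nextR k S p) q = mult σ.R q := by
  unfold evictions mult
  rw [← Finset.card_union_of_disjoint]
  · congr 1
    ext i
    simp only [nextR, Finset.mem_union, Finset.mem_filter, Finset.mem_univ, true_and,
      Finset.mem_sdiff, Finset.mem_insert, Finset.mem_inter, hq, false_or]
    tauto
  · rw [Finset.disjoint_left]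
    intro i
    simp

lemma evictions_self (k : ℕ) (S : Finset Page) (p : Page) (σ : LaneState Page T) :
    σ.evictions k S p p = 0 := by
  simp [evictions, nextR]

lemma mult_nextR_self (k : ℕ) (S : Finset Page) (p : Page) (σ : LaneState Page T) :
    mult (σ.nextR k S p) p = T + 1 := by
  simp [mult, nextR]

lemma Inv.round {k : ℕ} (hk : 1 ≤ k) {l : List Page} {σ : LaneState Page T} (h : σ.Inv k l)
    (p : Page) (x : ℕ) : (σ.round k (p :: l).toFinset p x).Inv k (p :: l) := by
  have hp : p ∈ (p :: l).toFinset := by simp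
  have hY := nextY_spec hk h (p :: l).toFinset p
  have hV := nextV_spec hk h hp
  have hm : ∀ q ≠ p, (σ.round k (p :: l).toFinset p x).m q = σ.m q := by
    intro q hq
    simp only [LaneState.round]
    split_ifs <;> simp [hq]
  have unseen : ∀ q ∉ p :: l, σ.nextY k (p :: l).toFinset p q = 1 := by
    intro q hq
    rw [nextY_unseen hk h _ p (by simpa using hq) (by rintro rfl; simp at hq)]
    exact h.y_unseen q fun hl => hq (List.mem_cons_of_mem _ hl)
  refine ⟨fun q => ⟨le_trans ?_ (hY.1 q).1, (hY.1 q).2⟩, unseen,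
    hV.2.1.change_class (mem_nextV_self hk h hp) fun q hq => round_cl _ _ _ _ _ hq,
    fun q => congrFun hV.1 q, fun i => ?_, fun i => ?_, fun q => ?_, fun q => ?_, fun q => ?_⟩
  · by_cases hq : q = p
    · subst hq; simp
    · simpa [hq] using (h.y_mem q).1
  -- The requested page fills `T + 1` places, and the other pages at most `(k - 1)(T + 1)`, since
  -- lane counts are rounded down.
  · refine hV.2.1.card_le (fun q => weightClass_le _ _ _) ?_ i
    rw [sum_card_eq_sum_mult (S := (p :: l).toFinset), hV.1, ← Finset.add_sum_erase _ _ hp,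
      nextY_self hk h, laneCount_zero]
    · have h1 := hY.2.2.1
      have h2 : ∑ q ∈ (p :: l).toFinset.erase p,
          (laneCount (T + 1) (σ.nextY k (p :: l).toFinset p q) : ℝ) ≤ (T + 1) * (k - 1) := by
        refine le_trans (Finset.sum_le_sum fun q _ => laneCount_le_mul _ _) ?_
        rw [← Finset.mul_sum]
        push_cast
        gcongr
      have h3 : ((T + 1 + ∑ q ∈ (p :: l).toFinset.erase p,
          laneCount (T + 1) (σ.nextY k (p :: l).toFinset p q) : ℕ) : ℝ) ≤ (k * (T + 1) : ℕ) := by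
        push_cast
        linarith
      exact_mod_cast h3
    · intro i q hq
      by_contra hn
      have e := congrFun hV.1 q
      simp only [unseen q (by simpa using hn), laneCount_one] at e
      rw [mult, Finset.card_eq_zero] at e
      have : i ∈ Finset.univ.filter (fun i => q ∈ σ.nextV k (p :: l).toFinset p i) := by
        simpa using hq
      rw [e] at this
      simp at this
  · intro q hq
    simp only [LaneState.round, nextR, Finset.mem_insert, Finset.mem_inter] at hq ⊢
    rcases hq with rfl | hq
    · exact mem_nextV_self hk h hp i
    · exact hq.2
  · by_cases hq : q = p
    · subst hq
      simp only [LaneState.round]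
      split_ifs with hd
      · rw [Function.update_self]
        exact le_trans hd (Nat.le_add_right _ _)
      · exact (h.m_le q).trans (Nat.le_add_right _ _)
    · rw [hm q hq]
      exact (h.m_le q).trans (Nat.le_add_right _ _)
  -- A request of `q` puts it into all `T + 1` lanes. Either no sample is due, so `D q < (m q + 1)(T
  -- + 1)`, or `m q` increases and absorbs these `T + 1` copies.
  · by_cases hq : q = p
    · subst hq
      have h1 := h.D_le q
      simp only [LaneState.round, evictions_self, mult_nextR_self]
      split_ifs with hd
      · rw [Function.update_self]
        nlinarith
      · have := not_le.1 hd
        nlinarith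
    · rw [hm q hq]
      have h1 := h.D_le q
      have h2 := evictions_add_mult k (p :: l).toFinset σ hq
      simp only [LaneState.round]
      omega
  · have h1 := h.D_le_count q
    by_cases hq : q = p
    · subst hq
      simp only [LaneState.round, evictions_self, mult_nextR_self, List.count_cons_self]
      nlinarith
    · have h2 := evictions_add_mult k (p :: l).toFinset σ hq
      simp only [LaneState.round, List.count_cons_of_ne (Ne.symm hq)]
      omega

lemma inv_after {k : ℕ} (hk : 1 ≤ k) (Y : Page → ℕ → ℕ) (l : List Page) :
    (after k T Y l).Inv k l := by
  induction l with
  | nil => exact inv_init k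
  | cons p l ih => exact ih.round hk p _

end LaneState

end

/-! ### Lazy competitors and the amortized cost of the lanes -/

section

variable {Page : Type} [DecidableEq Page]

/-- The lazy version of a schedule `C`: it fetches only requested pages, and evicts a page when `C`
does. The argument lists the requests served so far, latest first. -/
def lazySchedule (C : ℕ → Finset Page) : List Page → Finset Page
  | [] => ∅
  | p :: l => insert p (lazySchedule C l ∩ C (l.length + 1))

/-- The eviction cost of the lazy version of a schedule. -/
noncomputable def lazyCost (C : ℕ → Finset Page) (w : Page → ℝ) : List Page → ℝ
  | [] => 0
  | p :: l => lazyCost C w l + ∑ q ∈ lazySchedule C l \ lazySchedule C (p :: l), w q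

lemma lazySchedule_sub_toFinset (C : ℕ → Finset Page) (l : List Page) :
    lazySchedule C l ⊆ l.toFinset := by
  induction l with
  | nil => simp [lazySchedule]
  | cons p l ih =>
    intro q hq
    simp only [lazySchedule, Finset.mem_insert, Finset.mem_inter] at hq
    rw [List.toFinset_cons, Finset.mem_insert]
    exact hq.imp_right fun h => ih h.1

lemma lazySchedule_sub {C : ℕ → Finset Page} {l : List Page}
    (hC : ∀ p l', (p :: l') <:+ l → p ∈ C (l'.length + 1)) : lazySchedule C l ⊆ C l.length := by
  cases l with
  | nil => simp [lazySchedule]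
  | cons p l =>
    intro q hq
    simp only [lazySchedule, Finset.mem_insert, Finset.mem_inter] at hq
    rcases hq with rfl | hq
    · exact hC _ _ List.suffix_rfl
    · exact hq.2

lemma lazyCost_le {C : ℕ → Finset Page} {w : Page → ℝ} (hw : ∀ q, 0 ≤ w q) {l : List Page}
    (hC : ∀ p l', (p :: l') <:+ l → p ∈ C (l'.length + 1)) :
    lazyCost C w l ≤ ∑ t ∈ Finset.range l.length, ∑ q ∈ C t \ C (t + 1), w q := by
  induction l with
  | nil => simp [lazyCost]
  | cons p l ih =>
    have hC' : ∀ p l', (p :: l') <:+ l → p ∈ C (l'.length + 1) := fun q l' h =>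
      hC q l' (h.trans (List.suffix_cons _ _))
    rw [lazyCost, List.length_cons, Finset.sum_range_succ]
    refine add_le_add (ih hC') (Finset.sum_le_sum_of_subset_of_nonneg ?_ fun q _ _ => hw q)
    intro q hq
    simp only [lazySchedule, Finset.mem_sdiff, Finset.mem_insert, Finset.mem_inter] at hq ⊢
    exact ⟨lazySchedule_sub hC' hq.1, fun h => hq.2 (Or.inr ⟨hq.1, h⟩)⟩

/-- A lazy schedule fetches at most one page per request, so it evicts at most `l.length` times; an
arbitrary schedule has no such bound. The cache size is the potential in the induction. -/
lemma lazyCost_add_const_le (C : ℕ → Finset Page) (w : Page → ℝ) {ε : ℝ} (hε : 0 ≤ ε)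
    (l : List Page) : lazyCost C (fun q => w q + ε) l ≤ lazyCost C w l + ε * l.length := by
  suffices h : lazyCost C (fun q => w q + ε) l + ε * (lazySchedule C l).card
      ≤ lazyCost C w l + ε * l.length by
    have : 0 ≤ ε * (lazySchedule C l).card := by positivity
    linarith
  induction l with
  | nil => simp [lazyCost, lazySchedule]
  | cons p l ih =>
    have h1 : ((lazySchedule C l \ lazySchedule C (p :: l)).card : ℝ)
        + (lazySchedule C (p :: l)).card ≤ (lazySchedule C l).card + 1 := by
      have h2 : (lazySchedule C (p :: l)) ⊆
          insert p (lazySchedule C l ∩ lazySchedule C (p :: l)) := by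
        intro q hq
        simp only [lazySchedule, Finset.mem_insert, Finset.mem_inter] at hq ⊢
        tauto
      have h3 := (Finset.card_le_card h2).trans (Finset.card_insert_le _ _)
      have h4 := Finset.card_sdiff_add_card_inter (lazySchedule C l) (lazySchedule C (p :: l))
      have : (lazySchedule C l \ lazySchedule C (p :: l)).card
        + (lazySchedule C (p :: l)).card ≤ (lazySchedule C l).card + 1 := by omega
      exact_mod_cast this
    simp only [lazyCost, Finset.sum_add_distrib, Finset.sum_const, nsmul_eq_mul, List.length_cons]
    push_cast
    nlinarith

namespace LaneState

variable {T : ℕ}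

lemma sum_evictions (k : ℕ) (S : Finset Page) (p : Page) (σ : LaneState Page T) {P : Finset Page}
    (hP : ∀ i, σ.R i ⊆ P) (f : Page → ℝ) :
    evictCost f σ.R (σ.nextR k S p) = ∑ q ∈ P, f q * σ.evictions k S p q := by
  have e : ∀ i, ∑ q ∈ σ.R i \ σ.nextR k S p i, f q
      = ∑ q ∈ P, if q ∈ σ.R i \ σ.nextR k S p i then f q else 0 := by
    intro i
    rw [← Finset.sum_filter, Finset.filter_mem_eq_inter, Finset.inter_eq_right.2]
    exact Finset.sdiff_subset.trans (hP i)
  unfold evictCost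
  simp_rw [e]
  rw [Finset.sum_comm]
  refine Finset.sum_congr rfl fun q _ => ?_
  rw [← Finset.sum_filter, Finset.sum_const, nsmul_eq_mul, mul_comm]
  rfl

/-- The logarithmic potential with respect to a competitor that holds the pages in `L`. -/
noncomputable def logPotential (k : ℕ) (P L : Finset Page) (σ : LaneState Page T) : ℝ :=
  ∑ q ∈ P \ L, σ.wt q * (Real.log (2 + 1 / k) - Real.log (σ.y q + 1 / k))

/-- The weighted missing fractions in the lanes. -/
noncomputable def lanePotential (P : Finset Page) (σ : LaneState Page T) : ℝ :=
  ∑ q ∈ P, σ.wt q * (1 - laneCount (T + 1) (σ.y q) / (T + 1))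

/-- The weighted missing fractions. -/
noncomputable def massPotential (P : Finset Page) (σ : LaneState Page T) : ℝ :=
  ∑ q ∈ P, σ.wt q * σ.y q

lemma round_wt (k : ℕ) (S : Finset Page) (p : Page) (x : ℕ) (σ : LaneState Page T) {q : Page}
    (hq : q ≠ p) : (σ.round k S p x).wt q = σ.wt q := by
  rw [wt, wt, round_cl _ _ _ _ _ hq]

lemma log_term_mem {k : ℕ} (hk : 1 ≤ k) {y : ℝ} (hy : 0 ≤ y ∧ y ≤ 2) :
    0 ≤ Real.log (2 + 1 / k) - Real.log (y + 1 / k) ∧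
      Real.log (2 + 1 / k) - Real.log (y + 1 / k) ≤ Real.log (2 * k + 1) := by
  have hk0 : (0 : ℝ) < k := by exact_mod_cast hk
  have hk1 : (0 : ℝ) < 1 / k := by positivity
  constructor
  · exact sub_nonneg.2 (Real.log_le_log (by linarith) (by linarith))
  · have h1 : Real.log (1 / k) ≤ Real.log (y + 1 / k) := Real.log_le_log hk1 (by linarith)
    have h2 : Real.log (2 * k + 1) = Real.log (2 + 1 / k) - Real.log (1 / k) := by
      rw [← Real.log_div (by positivity) hk1.ne']
      congr 1
      field_simp
    linarith

/-- Pages other than `p` only leave lanes, so their change is exactly the increase of the lane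
potential. For `p` the potential falls; twice the fall is added back, with `2 / (T + 1)` for
rounding. -/
lemma lane_change_le {k : ℕ} (hk : 1 ≤ k) {l : List Page} {σ : LaneState Page T} (h : σ.Inv k l)
    (S : Finset Page) (p q : Page) :
    |(laneCount (T + 1) (σ.nextY k S p q) : ℝ) - mult σ.V q| / (T + 1) ≤
      (1 - laneCount (T + 1) (σ.nextY k S p q) / (T + 1)) -
        (1 - laneCount (T + 1) (σ.y q) / (T + 1)) +
        if q = p then 2 * σ.y p + 2 / (T + 1) else 0 := by
  have hT : (0 : ℝ) < T + 1 := by positivity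
  rw [h.mult_V]
  by_cases hq : q = p
  · subst hq
    have h1 := le_laneCount (T + 1) (h.y_mem q).1
    have h2 : (laneCount (T + 1) (σ.y q) : ℝ) ≤ T + 1 := by exact_mod_cast laneCount_le (T + 1) _
    rw [nextY_self hk h, laneCount_zero, if_pos rfl]
    push_cast at h1 ⊢
    rw [abs_of_nonneg (by linarith)]
    have h3 : (1 : ℝ) - laneCount (T + 1) (σ.y q) / (T + 1) ≤ σ.y q + 1 / (T + 1) := by
      rw [← sub_nonneg]
      have : σ.y q + 1 / (T + 1) - (1 - laneCount (T + 1) (σ.y q) / (T + 1))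
        = (laneCount (T + 1) (σ.y q) - (T + 1 - (T + 1) * σ.y q - 1)) / (T + 1) := by
        field_simp; ring
      rw [this]
      exact div_nonneg (by linarith) hT.le
    rw [sub_div, div_self hT.ne']
    have h4 : (2 : ℝ) / (T + 1) = 2 * (1 / (T + 1)) := by ring
    linarith
  · have h1 : σ.y q ≤ σ.nextY k S p q := by
      simpa [hq] using ((nextY_spec hk h S p).1 q).1
    have h2 : (laneCount (T + 1) (σ.nextY k S p q) : ℝ) ≤ laneCount (T + 1) (σ.y q) := by
      exact_mod_cast laneCount_anti (T + 1) h1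
    rw [abs_of_nonpos (by linarith), if_neg hq]
    apply le_of_eq
    ring

/-- The lane potential turns lane changes into their net growth plus a multiple of `wt p * y p`, the
mass that vanishes at the request. The mass potential turns the latter into the growth of the
fractions, and the log potential pays for it with factor `24 = 6 * 4`. A change of the estimate of
`p` is harmless: its terms in the first two potentials are 0 after the request, and the third omits
`p` because the competitor holds it. -/
lemma round_cost_le {k : ℕ} (hk : 1 ≤ k) {l : List Page} {σ : LaneState Page T} (h : σ.Inv k l)
    (p : Page) (x : ℕ) {P : Finset Page} (hP : (p :: l).toFinset ⊆ P) {L L' : Finset Page}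
    (hpL : p ∈ L') (hL' : L'.card ≤ k) :
    (∑ q ∈ P, σ.wt q * σ.evictions k (p :: l).toFinset p q) / (T + 1) ≤
      3 * ((σ.round k (p :: l).toFinset p x).lanePotential P - σ.lanePotential P) -
      6 * ((σ.round k (p :: l).toFinset p x).massPotential P - σ.massPotential P) -
      24 * ((σ.round k (p :: l).toFinset p x).logPotential k P L' - σ.logPotential k P L) +
      24 * Real.log (2 * k + 1) * ∑ q ∈ L \ L', σ.wt q + 6 / (T + 1) := by
  set S := (p :: l).toFinset with hS
  have hp : p ∈ S := by simp [hS]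
  have hT : (0 : ℝ) < T + 1 := by positivity
  have hRV : ∀ i, σ.R i ⊆ P := fun i q hq => hP <| by
    have := h.V_sub i (h.R_sub i hq)
    simp only [hS, List.mem_toFinset, List.mem_cons] at this ⊢
    exact Or.inr this
  have hY := nextY_spec hk h S p
  have h1 : ∑ q ∈ P, σ.wt q * σ.evictions k S p q ≤ evictCost σ.wt σ.V (σ.nextV k S p) := by
    rw [← sum_evictions k S p σ hRV]
    refine Finset.sum_le_sum fun i _ =>
      Finset.sum_le_sum_of_subset_of_nonneg ?_ fun q _ _ => (σ.wt_pos q).le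
    intro q hq
    simp only [nextR, Finset.mem_sdiff, Finset.mem_insert, Finset.mem_inter] at hq ⊢
    exact ⟨h.R_sub i hq.1, fun hn => hq.2 (Or.inr ⟨hq.1, hn⟩)⟩
  have h2 : evictCost σ.wt σ.V (σ.nextV k S p) ≤ 3 * ∑ q ∈ P, σ.wt q *
      |(laneCount (T + 1) (σ.nextY k S p q) : ℝ) - mult σ.V q| := by
    refine (nextV_spec hk h hp).2.2.trans ?_
    gcongr
    refine Finset.sum_le_sum_of_subset_of_nonneg hP fun q _ _ => ?_
    have := σ.wt_pos q
    exact mul_nonneg this.le (abs_nonneg _)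
  have h3 : (∑ q ∈ P, σ.wt q * |(laneCount (T + 1) (σ.nextY k S p q) : ℝ) - mult σ.V q|) / (T + 1) ≤
      ∑ q ∈ P, σ.wt q * (1 - laneCount (T + 1) (σ.nextY k S p q) / (T + 1)) - σ.lanePotential P
        + (2 * (σ.wt p * σ.y p) + 2 / (T + 1)) := by
    have e : 2 * (σ.wt p * σ.y p) + σ.wt p * (2 / (T + 1))
        = ∑ q ∈ P, σ.wt q * if q = p then 2 * σ.y p + 2 / (T + 1) else 0 := by
      rw [Finset.sum_eq_single p]
      · rw [if_pos rfl]; ring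
      · intro q _ hq; simp [hq]
      · intro hn; exact absurd (hP hp) hn
    have e' : σ.wt p * (2 / (T + 1)) ≤ 2 / (T + 1) :=
      mul_le_of_le_one_left (by positivity) (σ.wt_le_one p)
    have : (∑ q ∈ P, σ.wt q * |(laneCount (T + 1) (σ.nextY k S p q) : ℝ) - mult σ.V q|) / (T + 1) ≤
      ∑ q ∈ P, σ.wt q * (1 - laneCount (T + 1) (σ.nextY k S p q) / (T + 1)) - σ.lanePotential P
        + (2 * (σ.wt p * σ.y p) + σ.wt p * (2 / (T + 1))) := by
      rw [e, lanePotential, ← Finset.sum_sub_distrib, ← Finset.sum_add_distrib, Finset.sum_div]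
      refine Finset.sum_le_sum fun q _ => ?_
      have := mul_le_mul_of_nonneg_left (lane_change_le hk h S p q) (σ.wt_pos q).le
      rw [mul_div_assoc]
      linarith
    linarith
  have h4 : (σ.round k S p x).lanePotential P
      = ∑ q ∈ P, σ.wt q * (1 - laneCount (T + 1) (σ.nextY k S p q) / (T + 1)) := by
    refine Finset.sum_congr rfl fun q _ => ?_
    by_cases hq : q = p
    · subst hq
      simp only [LaneState.round]
      rw [nextY_self hk h, laneCount_zero]
      push_cast
      rw [div_self hT.ne']
      simp
    · rw [round_wt _ _ _ _ _ hq]; rfl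
  have h5 : (σ.round k S p x).massPotential P = ∑ q ∈ P, σ.wt q * σ.nextY k S p q := by
    refine Finset.sum_congr rfl fun q _ => ?_
    by_cases hq : q = p
    · subst hq
      simp only [LaneState.round]
      rw [nextY_self hk h]
      simp
    · rw [round_wt _ _ _ _ _ hq]; rfl
  have hSP : S.erase p ⊆ P := (Finset.erase_subset _ _).trans hP
  have h6 : ∑ q ∈ S.erase p, σ.wt q * (σ.nextY k S p q - Function.update σ.y p 0 q)
      = ∑ q ∈ P, σ.wt q * σ.nextY k S p q - σ.massPotential P + σ.wt p * σ.y p := by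
    have e : σ.wt p * σ.y p = ∑ q ∈ P, if q = p then σ.wt p * σ.y p else 0 := by
      rw [Finset.sum_ite_eq' P p, if_pos (hP hp)]
    rw [e, massPotential, ← Finset.sum_sub_distrib, ← Finset.sum_add_distrib,
      Finset.sum_subset hSP]
    · refine Finset.sum_congr rfl fun q _ => ?_
      by_cases hq : q = p
      · subst hq; rw [nextY_self hk h]; simp
      · simp [hq]; ring
    · intro q _ hq
      rw [hY.2.1 q hq]; simp
  -- The competitor holds `p`, so at most `k - 1` of its pages are among the growing ones.
  have h7 := hY.2.2.2 L' (by
    have : L' ∩ S.erase p ⊆ L'.erase p := by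
      intro q hq
      simp only [Finset.mem_inter, Finset.mem_erase] at hq ⊢
      exact ⟨hq.2.1, hq.1⟩
    have e := Finset.card_le_card this
    rw [Finset.card_erase_of_mem hpL] at e
    have := Finset.card_pos.2 ⟨p, hpL⟩
    omega)
  have h8 : ∑ q ∈ S.erase p \ L', σ.wt q *
      (Real.log (σ.nextY k S p q + 1 / k) - Real.log (Function.update σ.y p 0 q + 1 / k))
      = ∑ q ∈ P \ L', σ.wt q * (Real.log (2 + 1 / k) - Real.log (σ.y q + 1 / k))
        - (σ.round k S p x).logPotential k P L' := by
    rw [logPotential, ← Finset.sum_sub_distrib,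
      Finset.sum_subset (Finset.sdiff_subset_sdiff hSP le_rfl)]
    · refine Finset.sum_congr rfl fun q hq => ?_
      have hqp : q ≠ p := by
        rintro rfl
        exact (Finset.mem_sdiff.1 hq).2 hpL
      rw [round_wt _ _ _ _ _ hqp, Function.update_of_ne hqp]
      simp only [LaneState.round]
      ring
    · intro q hq hq'
      rw [hY.2.1 q fun hn => hq' (Finset.mem_sdiff.2 ⟨hn, (Finset.mem_sdiff.1 hq).2⟩)]
      simp
  have h9 : ∑ q ∈ P \ L', σ.wt q * (Real.log (2 + 1 / k) - Real.log (σ.y q + 1 / k)) ≤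
      σ.logPotential k P L + Real.log (2 * k + 1) * ∑ q ∈ L \ L', σ.wt q := by
    have hnn : ∀ q, 0 ≤ σ.wt q * (Real.log (2 + 1 / k) - Real.log (σ.y q + 1 / k)) := fun q =>
      mul_nonneg (σ.wt_pos q).le (log_term_mem hk (h.y_mem q)).1
    have hsub : P \ L' ⊆ (P \ L) ∪ (L \ L') := by
      intro q
      simp only [Finset.mem_sdiff, Finset.mem_union]
      tauto
    refine (Finset.sum_le_sum_of_subset_of_nonneg hsub fun q _ _ => hnn q).trans ?_
    have e := Finset.sum_union_inter (s₁ := P \ L) (s₂ := L \ L')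
      (f := fun q => σ.wt q * (Real.log (2 + 1 / k) - Real.log (σ.y q + 1 / k)))
    have e' : 0 ≤ ∑ q ∈ (P \ L) ∩ (L \ L'),
      σ.wt q * (Real.log (2 + 1 / k) - Real.log (σ.y q + 1 / k)) :=
      Finset.sum_nonneg fun q _ => hnn q
    have e'' : ∑ q ∈ L \ L', σ.wt q * (Real.log (2 + 1 / k) - Real.log (σ.y q + 1 / k)) ≤
        Real.log (2 * k + 1) * ∑ q ∈ L \ L', σ.wt q := by
      rw [Finset.mul_sum]
      refine Finset.sum_le_sum fun q _ => ?_
      rw [mul_comm]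
      exact mul_le_mul_of_nonneg_right (log_term_mem hk (h.y_mem q)).2 (σ.wt_pos q).le
    unfold logPotential
    linarith
  rw [h4, h5]
  have h10 : (∑ q ∈ P, σ.wt q * σ.evictions k S p q) / (T + 1) ≤
      3 * ((∑ q ∈ P, σ.wt q *
        |(laneCount (T + 1) (σ.nextY k S p q) : ℝ) - mult σ.V q|) / (T + 1)) := by
    rw [← mul_div_assoc]
    gcongr
    exact h1.trans h2
  have h11 : (6 : ℝ) / (T + 1) = 3 * (2 / (T + 1)) := by ring
  rw [h11]
  rw [h6, h8] at h7
  linarith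

/-- The estimated cost of the evictions of page `q` from all lazy lanes. -/
noncomputable def charge (k T : ℕ) (Y : Page → ℕ → ℕ) : List Page → Page → ℝ
  | [], _ => 0
  | p :: l, q => charge k T Y l q +
      (after k T Y l).wt q * (after k T Y l).evictions k (p :: l).toFinset p q

lemma charge_nonneg (k T : ℕ) (Y : Page → ℕ → ℕ) (l : List Page) (q : Page) :
    0 ≤ charge k T Y l q := by
  induction l with
  | nil => simp [charge]
  | cons p l ih =>
    have := (after k T Y l).wt_pos q
    rw [charge]
    positivity

/-- Summation of `round_cost_le`. The initial mass and log potentials are at most `P.card` each,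
hence `30 = 6 + 24`. -/
lemma sum_charge_le_potential {k : ℕ} (hk : 1 ≤ k) (Y : Page → ℕ → ℕ) {w' : Page → ℝ}
    {C : ℕ → Finset Page} (hCk : ∀ t, (C t).card ≤ k) {P : Finset Page} {l : List Page}
    (hlP : l.toFinset ⊆ P) (hC : ∀ p l', (p :: l') <:+ l → p ∈ C (l'.length + 1))
    (hw' : ∀ l', l' <:+ l → ∀ q ∈ P, (after k T Y l').wt q ≤ w' q) :
    (∑ q ∈ P, charge k T Y l q) / (T + 1) ≤
      3 * (after k T Y l).lanePotential P - 6 * (after k T Y l).massPotential P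
      - 24 * (after k T Y l).logPotential k P (lazySchedule C l)
      + 24 * Real.log (2 * k + 1) * lazyCost C w' l + 30 * P.card + 6 * l.length / (T + 1) := by
  have hk0 : (0 : ℝ) < k := by exact_mod_cast hk
  have hk1 : (0 : ℝ) < 1 / k := by positivity
  have hlog : 0 ≤ Real.log (2 * k + 1) := Real.log_nonneg (by linarith)
  induction l with
  | nil =>
    have h1 : 0 ≤ (init Page T).lanePotential P := by
      refine Finset.sum_nonneg fun q _ => mul_nonneg (wt_pos _ q).le ?_
      simp [init, laneCount_one]
    have h2 : (init Page T).massPotential P ≤ P.card := by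
      have : ∑ q ∈ P, (init Page T).wt q * (init Page T).y q ≤ ∑ _q ∈ P, (1 : ℝ) :=
        Finset.sum_le_sum fun q _ => by simpa [init] using (init Page T).wt_le_one q
      simpa [massPotential] using this
    have h3 : (init Page T).logPotential k P ∅ ≤ P.card := by
      have : ∑ q ∈ P, (init Page T).wt q *
          (Real.log (2 + 1 / k) - Real.log ((init Page T).y q + 1 / k)) ≤ ∑ _q ∈ P, (1 : ℝ) := by
        refine Finset.sum_le_sum fun q _ => ?_
        have e : Real.log (2 + 1 / k) - Real.log ((init Page T).y q + 1 / k) ≤ 1 := by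
          simp only [init]
          rw [← Real.log_div (by positivity) (by positivity)]
          have h5 : (2 + 1 / (k : ℝ)) / (1 + 1 / k) ≤ 2 := by
            rw [div_le_iff₀ (by positivity)]
            linarith
          have h6 := Real.log_le_log (by positivity) h5
          linarith [Real.log_two_lt_d9]
        have e0 : 0 ≤ Real.log (2 + 1 / (k : ℝ)) - Real.log ((init Page T).y q + 1 / k) :=
          (log_term_mem hk (by norm_num [init])).1
        exact mul_le_one₀ ((init Page T).wt_le_one q) e0 e
      simpa [logPotential] using this
    simp only [charge, after, lazySchedule, lazyCost, List.length_nil, Finset.sum_const_zero,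
      zero_div, Nat.cast_zero, mul_zero, add_zero]
    linarith
  | cons p l ih =>
    have hC' : ∀ p l', (p :: l') <:+ l → p ∈ C (l'.length + 1) := fun q l' h =>
      hC q l' (h.trans (List.suffix_cons _ _))
    have hlP' : l.toFinset ⊆ P := by
      refine subset_trans ?_ hlP
      rw [List.toFinset_cons]
      exact Finset.subset_insert _ _
    have e := ih hlP' hC' fun l' h => hw' l' (h.trans (List.suffix_cons _ _))
    have hL' : (lazySchedule C (p :: l)).card ≤ k :=
      (Finset.card_le_card (lazySchedule_sub hC)).trans (hCk _)
    have r := round_cost_le hk (inv_after (T := T) hk Y l) p (Y p ((after k T Y l).m p)) hlP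
      (L := lazySchedule C l) (L' := lazySchedule C (p :: l)) (by simp [lazySchedule]) hL'
    have hs : ∑ q ∈ lazySchedule C l \ lazySchedule C (p :: l), (after k T Y l).wt q ≤
        ∑ q ∈ lazySchedule C l \ lazySchedule C (p :: l), w' q :=
      Finset.sum_le_sum fun q hq => hw' l (List.suffix_cons _ _) q
        (hlP' (lazySchedule_sub_toFinset C l (Finset.mem_sdiff.1 hq).1))
    have hs' := mul_le_mul_of_nonneg_left hs (show 0 ≤ 24 * Real.log (2 * k + 1) by positivity)
    simp only [charge, lazyCost, Finset.sum_add_distrib, List.length_cons]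
    have ea : after k T Y (p :: l) =
      (after k T Y l).round k (p :: l).toFinset p (Y p ((after k T Y l).m p)) := rfl
    rw [ea, add_div, mul_add]
    push_cast
    have e3 : (6 : ℝ) * (l.length + 1) / (T + 1) = 6 * l.length / (T + 1) + 6 / (T + 1) := by ring
    rw [e3]
    linarith

/-- The estimated cost of the lanes is at most `O(log k)` times the cost of a schedule. -/
theorem sum_charge_le {k : ℕ} (hk : 1 ≤ k) (Y : Page → ℕ → ℕ) {w : Page → ℝ} (hw : ∀ q, 0 ≤ w q)
    {C : ℕ → Finset Page} (hCk : ∀ t, (C t).card ≤ k) {l : List Page} (hl : l.length = T)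
    (hC : ∀ p l', (p :: l') <:+ l → p ∈ C (l'.length + 1))
    (hw' : ∀ l', l' <:+ l → ∀ q ∈ l.toFinset, (after k T Y l').wt q ≤ w q + (1 / 2) ^ T) :
    (∑ q ∈ l.toFinset, charge k T Y l q) / (T + 1) ≤
      24 * Real.log (2 * k + 1) *
        (∑ t ∈ Finset.range T, ∑ q ∈ C t \ C (t + 1), w q + 1) + 33 * l.toFinset.card + 6 := by
  have hk0 : (0 : ℝ) < k := by exact_mod_cast hk
  have hlog : 0 ≤ Real.log (2 * k + 1) := Real.log_nonneg (by linarith)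
  have hinv := inv_after (T := T) hk Y l
  have h := sum_charge_le_potential hk Y hCk (Finset.Subset.refl l.toFinset) hC hw'
  have h1 : (after k T Y l).lanePotential l.toFinset ≤ l.toFinset.card := by
    have : ∑ q ∈ l.toFinset, (after k T Y l).wt q *
        (1 - laneCount (T + 1) ((after k T Y l).y q) / (T + 1)) ≤ ∑ _q ∈ l.toFinset, (1 : ℝ) := by
      refine Finset.sum_le_sum fun q _ => ?_
      have a : (0 : ℝ) ≤ laneCount (T + 1) ((after k T Y l).y q) / (T + 1) := by positivity
      have b : (laneCount (T + 1) ((after k T Y l).y q) : ℝ) / (T + 1) ≤ 1 := by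
        rw [div_le_one (by positivity)]
        exact_mod_cast laneCount_le (T + 1) _
      exact mul_le_one₀ (wt_le_one _ q) (by linarith) (by linarith)
    simpa [lanePotential] using this
  have h2 : 0 ≤ (after k T Y l).massPotential l.toFinset :=
    Finset.sum_nonneg fun q _ => mul_nonneg (wt_pos _ q).le (hinv.y_mem q).1
  have h3 : 0 ≤ (after k T Y l).logPotential k l.toFinset (lazySchedule C l) :=
    Finset.sum_nonneg fun q _ => mul_nonneg (wt_pos _ q).le (log_term_mem hk (hinv.y_mem q)).1
  have h4 : lazyCost C (fun q => w q + (1 / 2) ^ T) l ≤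
      ∑ t ∈ Finset.range T, ∑ q ∈ C t \ C (t + 1), w q + 1 := by
    refine (lazyCost_add_const_le C w (by positivity) l).trans ?_
    have a := lazyCost_le hw hC
    rw [hl] at a ⊢
    -- The error `2⁻ᵀ` of the estimates is paid at most `T` times; likewise the rounding loss `6 /
    -- (T + 1)`, which is why there are `T + 1` lanes.
    have b : (1 / 2 : ℝ) ^ T * T ≤ 1 := by
      rw [one_div, inv_pow, inv_mul_le_iff₀ (by positivity), mul_one]
      exact_mod_cast Nat.lt_two_pow_self.le
    linarith
  have h5 : (6 : ℝ) * l.length / (T + 1) ≤ 6 := by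
    rw [hl, div_le_iff₀ (by positivity)]
    linarith
  have h6 := mul_le_mul_of_nonneg_left h4 (show 0 ≤ 24 * Real.log (2 * k + 1) by positivity)
  linarith

lemma D_add_evictions_le {k : ℕ} {l : List Page} {σ : LaneState Page T} (h : σ.Inv k l)
    (S : Finset Page) (p q : Page) :
    σ.D q + σ.evictions k S p q ≤ (σ.m q + 2) * (T + 1) := by
  have h1 := h.D_le q
  by_cases hq : q = p
  · subst hq
    rw [evictions_self]
    omega
  · have := evictions_add_mult k S σ hq
    omega

/-- The true cost of the evictions of a page is comparable to the estimated one, up to the cost of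
learning its weight. -/
theorem weight_mul_D_le {k : ℕ} (hk : 1 ≤ k) (Y : Page → ℕ → ℕ) {w K : ℝ} (hw0 : 0 ≤ w)
    (hw1 : w ≤ 1) (hK0 : 0 ≤ K) {l : List Page} (q : Page)
    (hK : ∀ l', l' <:+ l → (after k T Y l').wt q ≤ w / 16 → w * (after k T Y l').m q + 2 ≤ K) :
    w * (after k T Y l).D q ≤ 16 * charge k T Y l q + K * (T + 1) := by
  induction l with
  | nil => simp [after, init, charge]; positivity
  | cons p l ih =>
    have e : (after k T Y (p :: l)).D q =
      (after k T Y l).D q + (after k T Y l).evictions k (p :: l).toFinset p q := rfl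
    -- Up to the last time when the estimate is far too small, all evictions are bounded through the
    -- number of samples; later ones are charged at least `w / 16` each.
    by_cases hs : (after k T Y l).wt q ≤ w / 16
    · have h1 := D_add_evictions_le (inv_after (T := T) hk Y l) (p :: l).toFinset p q
      rw [← e] at h1
      have h2 : ((after k T Y (p :: l)).D q : ℝ) ≤ ((after k T Y l).m q + 2) * (T + 1) := by
        exact_mod_cast h1
      have h3 := hK l (List.suffix_cons _ _) hs
      have h4 := charge_nonneg k T Y (p :: l) q
      have h5 := mul_le_mul_of_nonneg_left h2 hw0
      have h6 : w * (((after k T Y l).m q + 2) * (T + 1)) ≤ K * (T + 1) := by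
        rw [← mul_assoc]
        gcongr
        linarith
      linarith
    · have h1 := ih fun l' h => hK l' (h.trans (List.suffix_cons _ _))
      rw [e, charge]
      push Not at hs
      have h2 := mul_le_mul_of_nonneg_right (show w ≤ 16 * (after k T Y l).wt q by linarith)
        (Nat.cast_nonneg (α := ℝ) ((after k T Y l).evictions k (p :: l).toFinset p q))
      push_cast
      linarith

/-- The cost of lane `i`, including the evictions that serve to obtain samples. -/
noncomputable def laneCost (k T : ℕ) (Y : Page → ℕ → ℕ) (w : Page → ℝ) (i : Fin (T + 1)) :
    List Page → ℝ
  | [] => 0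
  | p :: l => laneCost k T Y w i l +
      (∑ q ∈ (after k T Y l).R i \ (after k T Y (p :: l)).R i, w q +
        if (after k T Y l).Due p then w p else 0)

lemma laneCost_nonneg (k T : ℕ) (Y : Page → ℕ → ℕ) {w : Page → ℝ} (hw : ∀ q, 0 ≤ w q)
    (i : Fin (T + 1)) (l : List Page) : 0 ≤ laneCost k T Y w i l := by
  induction l with
  | nil => exact le_rfl
  | cons p l ih =>
    rw [laneCost]
    have : 0 ≤ ∑ q ∈ (after k T Y l).R i \ (after k T Y (p :: l)).R i, w q :=
      Finset.sum_nonneg fun q _ => hw q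
    have := hw p
    split_ifs <;> linarith

lemma sum_laneCost {k : ℕ} (hk : 1 ≤ k) (Y : Page → ℕ → ℕ) (w : Page → ℝ) {P : Finset Page}
    {l : List Page} (hlP : l.toFinset ⊆ P) :
    ∑ i, laneCost k T Y w i l =
      ∑ q ∈ P, w q * ((after k T Y l).D q + (T + 1) * (after k T Y l).m q) := by
  induction l with
  | nil => simp [laneCost, after, init]
  | cons p l ih =>
    have hlP' : l.toFinset ⊆ P := by
      refine subset_trans ?_ hlP
      rw [List.toFinset_cons]
      exact Finset.subset_insert _ _
    have hpP : p ∈ P := hlP (by simp)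
    have hinv := inv_after (T := T) hk Y l
    have e1 : ∑ i, ∑ q ∈ (after k T Y l).R i \ (after k T Y (p :: l)).R i, w q =
        ∑ q ∈ P, w q * (after k T Y l).evictions k (p :: l).toFinset p q :=
      sum_evictions k _ p _ (fun i => (hinv.R_sub i).trans ((hinv.V_sub i).trans hlP')) w
    have e2 : ∑ _i : Fin (T + 1), (if (after k T Y l).Due p then w p else 0)
        = ∑ q ∈ P, w q * ((T + 1) * if q = p ∧ (after k T Y l).Due p then 1 else 0) := by
      rw [Finset.sum_eq_single p]
      · simp [mul_comm]
      · intro q _ hq; simp [hq]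
      · intro h; exact absurd hpP h
    simp only [laneCost, Finset.sum_add_distrib]
    rw [ih hlP', e1, e2, ← Finset.sum_add_distrib, ← Finset.sum_add_distrib]
    refine Finset.sum_congr rfl fun q _ => ?_
    simp only [after, round]
    by_cases hd : (after k T Y l).Due p
    · by_cases hq : q = p
      · subst hq
        simp [hd]
        ring
      · simp [hd, hq]
        ring
    · simp [hd]
      ring

/-- Each sample costs `T + 1` extra evictions, one per lane, and was preceded by as many ordinary
ones, so sampling at most doubles the cost. -/
lemma sum_laneCost_le {k : ℕ} (hk : 1 ≤ k) (Y : Page → ℕ → ℕ) {w : Page → ℝ} (hw : ∀ q, 0 ≤ w q)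
    (l : List Page) :
    ∑ i, laneCost k T Y w i l ≤ 2 * ∑ q ∈ l.toFinset, w q * (after k T Y l).D q := by
  rw [sum_laneCost hk Y w (Finset.Subset.refl _), Finset.mul_sum]
  refine Finset.sum_le_sum fun q _ => ?_
  have h : ((after k T Y l).m q : ℝ) * (T + 1) ≤ (after k T Y l).D q := by
    exact_mod_cast (inv_after (T := T) hk Y l).m_le q
  have := mul_le_mul_of_nonneg_left h (hw q)
  linarith

/-- The crude bound for the event that the samples are not concentrated. -/
lemma sum_laneCost_le_length {k : ℕ} (hk : 1 ≤ k) (Y : Page → ℕ → ℕ) {w : Page → ℝ}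
    (hw : ∀ q, 0 ≤ w q) (hw1 : ∀ q, w q ≤ 1) (l : List Page) :
    ∑ i, laneCost k T Y w i l ≤ 2 * l.length * (T + 1) := by
  refine (sum_laneCost_le hk Y hw l).trans ?_
  have h : ∑ q ∈ l.toFinset, w q * (after k T Y l).D q ≤
      ∑ q ∈ l.toFinset, (l.count q : ℝ) * (T + 1) := by
    refine Finset.sum_le_sum fun q _ => ?_
    have h1 := (inv_after (T := T) hk Y l).D_le_count q
    have h2 : ((after k T Y l).D q : ℝ) ≤ l.count q * (T + 1) := by
      exact_mod_cast (Nat.le_add_right _ _).trans h1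
    have := mul_le_of_le_one_left (Nat.cast_nonneg (α := ℝ) ((after k T Y l).D q)) (hw1 q)
    linarith
  rw [← Finset.sum_mul] at h
  have e : ∑ q ∈ l.toFinset, (l.count q : ℝ) = l.length := by
    exact_mod_cast List.sum_toFinset_count_eq_length l
  rw [e] at h
  linarith

lemma m_le_length {k : ℕ} (hk : 1 ≤ k) (Y : Page → ℕ → ℕ) (l : List Page) (q : Page) :
    (after k T Y l).m q ≤ l.length := by
  have h := inv_after (T := T) hk Y l
  have h1 := h.m_le q
  have h2 := h.D_le_count q
  have h3 : (after k T Y l).m q * (T + 1) ≤ l.count q * (T + 1) := by omega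
  exact (Nat.le_of_mul_le_mul_right h3 (by omega)).trans List.count_le_length

lemma s_after (k : ℕ) (Y : Page → ℕ → ℕ) (l : List Page) (q : Page) :
    (after k T Y l).s q = ∑ j ∈ Finset.range ((after k T Y l).m q), Y q j := by
  induction l with
  | nil => simp [after, init]
  | cons p l ih =>
    simp only [after, round]
    split_ifs with hd
    · by_cases hq : q = p
      · subst hq
        rw [Function.update_self, Function.update_self, Finset.sum_range_succ, ih]
      · rw [Function.update_of_ne hq, Function.update_of_ne hq, ih]
    · exact ih

end LaneState

end

/-! ### The online algorithm that runs one lane, and its correctness -/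

section

variable {Page : Type} [DecidableEq Page]

/-- The samples received so far, by page and number: this is read off from the operations and the
samples of a run (latest first). -/
def sampleTable : List (Op Page) → List ℕ → Page → ℕ → ℕ
  | [], _ => fun _ _ => 0
  | .evict _ :: _, [] => fun _ _ => 0
  | .evict q :: ops, x :: xs => fun p j =>
      if p = q ∧ j = ops.count (.evict q) then x else sampleTable ops xs p j
  | .fetch _ :: ops, xs => sampleTable ops xs
  | .serve :: ops, xs => sampleTable ops xs

/-- The samples rounded up to multiples of `1 / (T + 1)`. -/
noncomputable def quantize (T : ℕ) (x : ℝ) : ℕ := ⌈x * (T + 1)⌉₊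

namespace LaneState

variable {T : ℕ}

/-- The operations of lane `i` when page `p` is requested, after the requests `l`. -/
noncomputable def plan (k : ℕ) (i : Fin (T + 1)) (p : Page) (l : List Page)
    (σ : LaneState Page T) : List (Op Page) :=
  ((σ.R i \ σ.nextR k (p :: l).toFinset p i).toList.map Op.evict
    ++ if p ∈ σ.R i then [] else [Op.fetch p])
    ++ if σ.Due p then [Op.evict p, Op.fetch p] else []

end LaneState

open LaneState

/-- The next operation of lane `i`. -/
noncomputable def nextOp (k T : ℕ) (i : Fin (T + 1)) (reqs : List Page) (ops : List (Op Page))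
    (xs : List ℕ) : Op Page :=
  match reqs.reverse with
  | [] => .serve
  | p :: l => (plan k i p l (after k T (sampleTable ops xs) l)).getD
      (ops.takeWhile (fun o => o ≠ .serve)).length .serve

/-- The algorithm: choose one of the `T + 1` lazy lanes uniformly at random. -/
noncomputable def lanesAlgorithm (Page : Type) [DecidableEq Page] (k T : ℕ) :
    OnlineAlgorithm Page where
  Seed := Fin (T + 1)
  seedSpace := ⊤
  seedLaw := (PMF.uniformOfFintype (Fin (T + 1))).toMeasure
  seedProb := inferInstance
  next i reqs ops samples := nextOp k T i reqs ops (samples.map (quantize T))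
  measurable_next reqs ops m := by
    -- Quantized samples make the decision factor through a countable discrete space, on which every
    -- function is measurable.
    have h : (fun z : Fin (T + 1) × (Fin m → ℝ) =>
        nextOp k T z.1 reqs ops ((List.ofFn z.2).map (quantize T))) =
        (fun u : Fin (T + 1) × (Fin m → ℕ) => nextOp k T u.1 reqs ops (List.ofFn u.2)) ∘
          (fun z : Fin (T + 1) × (Fin m → ℝ) => (z.1, fun j => quantize T (z.2 j))) := by
      funext z
      simp [List.map_ofFn, Function.comp_def]
    rw [h]
    refine Measurable.comp (Measurable.of_discrete) ?_
    refine Measurable.prodMk measurable_fst (measurable_pi_lambda _ fun j => ?_)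
    unfold quantize
    fun_prop

/-- The operations in the list can be performed in turn, starting with cache `S` and ending with
cache `S'`. -/
inductive Legal (k : ℕ) (seen : List Page) : List (Op Page) → Finset Page → Finset Page → Prop
  | nil (S : Finset Page) : Legal k seen [] S S
  | evict {q : Page} {ops : List (Op Page)} {S S' : Finset Page} (hq : q ∈ S)
      (h : Legal k seen ops (S.erase q) S') : Legal k seen (.evict q :: ops) S S'
  | fetch {q : Page} {ops : List (Op Page)} {S S' : Finset Page} (hq : q ∈ seen) (hqS : q ∉ S)
      (hk : S.card < k) (h : Legal k seen ops (insert q S) S') :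
      Legal k seen (.fetch q :: ops) S S'

lemma Legal.append {k : ℕ} {seen : List Page} {o₁ o₂ : List (Op Page)} {S S' S'' : Finset Page}
    (h₁ : Legal k seen o₁ S S') (h₂ : Legal k seen o₂ S' S'') :
    Legal k seen (o₁ ++ o₂) S S'' := by
  induction h₁ with
  | nil => exact h₂
  | evict hq _ ih => exact .evict hq (ih h₂)
  | fetch hq hqS hk _ ih => exact .fetch hq hqS hk (ih h₂)

lemma Legal.ne_serve {k : ℕ} {seen : List Page} {ops : List (Op Page)} {S S' : Finset Page}
    (h : Legal k seen ops S S') : ∀ o ∈ ops, o ≠ .serve := by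
  induction h with
  | nil => simp
  | evict _ _ ih => simpa using ih
  | fetch _ _ _ _ ih => simpa using ih

lemma legal_evict_list (k : ℕ) (seen : List Page) (L : List Page) (hL : L.Nodup) (S : Finset Page)
    (hS : ∀ q ∈ L, q ∈ S) : Legal k seen (L.map Op.evict) S (S \ L.toFinset) := by
  induction L generalizing S with
  | nil => simpa using Legal.nil S
  | cons q L ih =>
    have hq := List.nodup_cons.1 hL
    refine .evict (hS q (by simp)) ?_
    have := ih hq.2 (S.erase q) fun r hr => Finset.mem_erase.2
      ⟨by rintro rfl; exact hq.1 hr, hS r (by simp [hr])⟩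
    convert this using 1
    ext r
    simp only [List.toFinset_cons, Finset.mem_sdiff, Finset.mem_insert, Finset.mem_erase]
    tauto

lemma legal_plan {k T : ℕ} (i : Fin (T + 1)) {p : Page} (l : List Page) (σ : LaneState Page T)
    {seen : List Page} (hp : p ∈ seen) (hk : (σ.nextR k (p :: l).toFinset p i).card ≤ k) :
    Legal k seen (plan k i p l σ) (σ.R i) (σ.nextR k (p :: l).toFinset p i) := by
  set R' := σ.nextR k (p :: l).toFinset p i with hR'
  have hpR' : p ∈ R' := by simp [hR', nextR]
  have hsub : ∀ q ∈ R', q = p ∨ q ∈ σ.R i := by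
    intro q hq
    simp only [hR', nextR, Finset.mem_insert, Finset.mem_inter] at hq
    tauto
  refine Legal.append (Legal.append (S' := σ.R i ∩ R') ?_ (S'' := R') ?_) ?_
  · have := legal_evict_list k seen (σ.R i \ R').toList (Finset.nodup_toList _) (σ.R i)
      fun q hq => (Finset.mem_sdiff.1 (Finset.mem_toList.1 hq)).1
    rwa [Finset.toList_toFinset, sdiff_sdiff_right_self] at this
  · split_ifs with h
    · have : σ.R i ∩ R' = R' := Finset.inter_eq_right.2 fun q hq => by
        rcases hsub q hq with rfl | hq
        · exact h
        · exact hq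
      rw [this]
      exact .nil _
    · have e : insert p (σ.R i ∩ R') = R' := by
        ext q
        have := hsub q
        simp only [Finset.mem_insert, Finset.mem_inter]
        constructor
        · rintro (rfl | hq)
          · exact hpR'
          · exact hq.2
        · tauto
      have hn : p ∉ σ.R i ∩ R' := fun hn => h (Finset.mem_inter.1 hn).1
      refine .fetch hp hn ?_ (by rw [e]; exact .nil _)
      have := congrArg Finset.card e
      rw [Finset.card_insert_of_notMem hn] at this
      omega
  · split_ifs
    · refine .evict hpR' (.fetch hp (by simp) ?_ ?_)
      · rw [Finset.card_erase_of_mem hpR']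
        have := Finset.card_pos.2 ⟨p, hpR'⟩
        omega
      · rw [Finset.insert_erase hpR']
        exact .nil _
    · exact .nil _

/-- The table of the quantized samples. -/
noncomputable def quantTable (T : ℕ) (X : Page × ℕ → ℝ) (p : Page) (j : ℕ) : ℕ :=
  quantize T (X (p, j))

/-- The samples recorded in a state are the ones of the table `X`. -/
def Recorded (T : ℕ) (X : Page × ℕ → ℝ) (s : State Page) : Prop :=
  ∀ p, ∀ j < s.ops.count (.evict p),
    sampleTable s.ops (s.samples.map (quantize T)) p j = quantTable T X p j

lemma takeWhile_length {π ops : List (Op Page)} (hπ : ∀ o ∈ π, o ≠ .serve)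
    (hops : ops = [] ∨ ∃ ops', ops = .serve :: ops') :
    ((π.reverse ++ ops).takeWhile (fun o => o ≠ .serve)).length = π.length := by
  rw [List.takeWhile_append_of_pos]
  · rcases hops with rfl | ⟨ops', rfl⟩ <;> simp
  · intro o ho
    simpa using hπ o (List.mem_reverse.1 ho)

section Run

variable {k T : ℕ} {reqs : List Page} {i : Fin (T + 1)} {X : Page × ℕ → ℝ}

/-- The algorithm recomputes the simulation from its own samples, which agree with the full table
wherever the simulation reads it. Its position in the plan is the number of operations since the
last `serve`. -/
lemma next_eq {p : Page} {l : List Page} (hreqs : reqs.take (l.length + 1) = (p :: l).reverse)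
    {s : State Page} (hs : s.served = l.length) {ops₀ π₁ π₂ : List (Op Page)}
    (hops : s.ops = π₁.reverse ++ ops₀) (hπ : plan k i p l (after k T (quantTable T X) l) = π₁ ++ π₂)
    (hns : ∀ o ∈ π₁ ++ π₂, o ≠ .serve) (h₀ : ops₀ = [] ∨ ∃ ops', ops₀ = .serve :: ops')
    (hrec : Recorded T X s)
    (hm : ∀ q, (after k T (quantTable T X) l).m q ≤ ops₀.count (.evict q)) :
    (lanesAlgorithm Page k T).next i (reqs.take (s.served + 1)) s.ops s.samples =
      π₂.head?.getD .serve := by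
  have e : after k T (quantTable T X) l =
      after k T (sampleTable s.ops (s.samples.map (quantize T))) l := by
    refine after_congr k _ _ l fun q j hj => (hrec q j ?_).symm
    refine hj.trans_le ((hm q).trans ?_)
    rw [hops, List.count_append]
    omega
  show nextOp k T i (reqs.take (s.served + 1)) s.ops (s.samples.map (quantize T)) = _
  rw [hs, hreqs, nextOp, List.reverse_reverse]
  simp only
  rw [← e, hπ, hops, takeWhile_length (fun o ho => hns o (List.mem_append_left _ ho)) h₀,
    List.getD_append_right _ _ _ _ le_rfl, Nat.sub_self]
  cases π₂ <;> rfl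

/-- Induction over the rest `π₂` of the plan, with `π₁` already performed. Samples arriving within
the round do not alter the plan, as the state before the round uses only older ones. -/
lemma run_plan {p : Page} {l : List Page} (hreqs : reqs.take (l.length + 1) = (p :: l).reverse)
    (hget : reqs[l.length]? = some p) {ops₀ : List (Op Page)}
    (h₀ : ops₀ = [] ∨ ∃ ops', ops₀ = .serve :: ops')
    (hm : ∀ q, (after k T (quantTable T X) l).m q ≤ ops₀.count (.evict q))
    (π₂ π₁ : List (Op Page)) (s : State Page) {S' : Finset Page}
    (hs : s.served = l.length) (hops : s.ops = π₁.reverse ++ ops₀)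
    (hπ : plan k i p l (after k T (quantTable T X) l) = π₁ ++ π₂)
    (hns : ∀ o ∈ π₁ ++ π₂, o ≠ .serve) (hrec : Recorded T X s)
    (hleg : Legal k (reqs.take (l.length + 1)) π₂ s.cache S') (hpS : p ∈ S') :
    ∃ n, ∃ s' : State Page, ((lanesAlgorithm Page k T).step k reqs i X)^[n] s = s' ∧
      s'.served = l.length + 1 ∧ s'.cache = S' ∧
      s'.ops = .serve :: ((π₁ ++ π₂).reverse ++ ops₀) ∧ Recorded T X s' := by
  have hnext := next_eq hreqs hs hops hπ hns h₀ hrec hm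
  have hget' : reqs[s.served]? = some p := by rw [hs]; exact hget
  induction π₂ generalizing π₁ s with
  | nil =>
    cases hleg
    refine ⟨1, _, rfl, ?_⟩
    simp only [List.head?_nil, Option.getD_none] at hnext
    simp only [Function.iterate_one, OnlineAlgorithm.step, hget', hnext, if_pos hpS]
    refine ⟨by rw [hs], trivial, by simp [hops], ?_⟩
    intro q j hj
    simp only [List.count_cons] at hj
    exact hrec q j (by simpa using hj)
  | cons o π₂ ih =>
    simp only [List.head?_cons, Option.getD_some] at hnext
    have key : ∃ s' : State Page, (lanesAlgorithm Page k T).step k reqs i X s = s' ∧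
        s'.served = l.length ∧ s'.ops = (π₁ ++ [o]).reverse ++ ops₀ ∧ Recorded T X s' ∧
        Legal k (reqs.take (l.length + 1)) π₂ s'.cache S' := by
      cases hleg with
      | @evict q _ _ _ hq h =>
        refine ⟨_, rfl, ?_⟩
        simp only [OnlineAlgorithm.step, hget', hnext, if_pos hq]
        refine ⟨hs, by simp [hops], ?_, h⟩
        intro r j hj
        simp only [List.map_cons, sampleTable]
        split_ifs with hc
        · rw [hc.1, hc.2]; rfl
        · refine hrec r j ?_
          simp only [List.count_cons] at hj
          by_cases hrq : r = q
          · subst hrq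
            simp at hj hc
            omega
          · have : (Op.evict q == Op.evict r) = false := by
              simpa using fun h => hrq h.symm
            simpa [this] using hj
      | @fetch q _ _ _ hq hqS hk h =>
        refine ⟨_, rfl, ?_⟩
        have hcond : q ∈ reqs.take (s.served + 1) ∧ q ∉ s.cache ∧ s.cache.card < k :=
          ⟨by rwa [hs], hqS, hk⟩
        simp only [OnlineAlgorithm.step, hget', hnext, if_pos hcond]
        refine ⟨hs, by simp [hops], ?_, h⟩
        intro r j hj
        simp only [List.count_cons] at hj
        exact hrec r j (by simpa using hj)
    obtain ⟨s₁, hstep, hs₁, hops₁, hrec₁, hleg₁⟩ := key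
    have hπ' : plan k i p l (after k T (quantTable T X) l) = (π₁ ++ [o]) ++ π₂ := by
      rw [hπ]; simp
    have hns' : ∀ o' ∈ (π₁ ++ [o]) ++ π₂, o' ≠ .serve := by
      intro o' ho'
      exact hns o' (by simpa using ho')
    obtain ⟨n, s', h1, h2, h3, h4, h5⟩ := ih (π₁ ++ [o]) s₁ hs₁ hops₁ hπ' hns' hrec₁ hleg₁
      (next_eq hreqs hs₁ hops₁ hπ' hns' h₀ hrec₁ hm) (by rw [hs₁]; exact hget)
    refine ⟨n + 1, s', ?_, h2, h3, by simpa using h4, h5⟩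
    rw [Function.iterate_succ_apply, hstep, h1]

lemma plan_cost (w : Page → ℝ) (p : Page) (l : List Page) (σ : LaneState Page T) :
    ((plan k i p l σ).map (Op.cost w)).sum =
      ∑ q ∈ σ.R i \ σ.nextR k (p :: l).toFinset p i, w q + if σ.Due p then w p else 0 := by
  unfold plan
  simp only [List.map_append, List.sum_append, List.map_map]
  have e : (List.map (Op.cost w ∘ Op.evict)
      (σ.R i \ σ.nextR k (p :: l).toFinset p i).toList).sum =
      ∑ q ∈ σ.R i \ σ.nextR k (p :: l).toFinset p i, w q := by
    rw [← Finset.sum_map_toList]; rfl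
  rw [e]
  split_ifs <;> simp [Op.cost]

lemma run_add (A : OnlineAlgorithm Page) (k : ℕ) (reqs : List Page) (ω : A.Seed)
    (X : Page × ℕ → ℝ) (m n : ℕ) :
    A.run k reqs ω X (m + n) = (A.step k reqs ω X)^[m] (A.run k reqs ω X n) :=
  Function.iterate_add_apply _ _ _ _

lemma run_succ (A : OnlineAlgorithm Page) (k : ℕ) (reqs : List Page) (ω : A.Seed)
    (X : Page × ℕ → ℝ) (n : ℕ) :
    A.run k reqs ω X (n + 1) = A.step k reqs ω X (A.run k reqs ω X n) :=
  Function.iterate_succ_apply' _ _ _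

lemma step_of_none (A : OnlineAlgorithm Page) (ω : A.Seed) (s : State Page)
    (h : reqs[s.served]? = none) : A.step k reqs ω X s = s := by
  simp only [OnlineAlgorithm.step, h]

/-- The run of lane `i` follows the simulation. -/
theorem run_after (hk : 1 ≤ k) (w : Page → ℝ) (l : List Page) (hl : l <:+ reqs.reverse) :
    ∃ n, ∃ s : State Page, (lanesAlgorithm Page k T).run k reqs i X n = s ∧
      s.served = l.length ∧ s.cache = (after k T (quantTable T X) l).R i ∧
      (s.ops = [] ∨ ∃ ops', s.ops = .serve :: ops') ∧ Recorded T X s ∧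
      (∀ q, (after k T (quantTable T X) l).m q ≤ s.ops.count (.evict q)) ∧
      (s.ops.map (Op.cost w)).sum = laneCost k T (quantTable T X) w i l := by
  induction l with
  | nil =>
    refine ⟨0, _, rfl, rfl, rfl, Or.inl rfl, ?_, ?_, rfl⟩
    · intro q j hj
      simp [OnlineAlgorithm.run] at hj
    · intro q
      simp [after, init]
  | cons p l ih =>
    obtain ⟨n, s, hrun, hs, hc, h₀, hrec, hm, hcost⟩ := ih ((List.suffix_cons _ _).trans hl)
    obtain ⟨rest, hrest⟩ := hl
    have hreqs' : reqs = l.reverse ++ p :: rest.reverse := by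
      have := congrArg List.reverse hrest
      rw [List.reverse_reverse] at this
      rw [← this]; simp
    have hreqs : reqs.take (l.length + 1) = (p :: l).reverse := by
      rw [hreqs']
      have : l.reverse ++ p :: rest.reverse = (p :: l).reverse ++ rest.reverse := by simp
      rw [this, List.take_append_of_le_length (by simp), List.take_of_length_le (by simp)]
    have hget : reqs[l.length]? = some p := by
      rw [hreqs', List.getElem?_append_right (by simp)]
      simp
    have hinv := inv_after (T := T) hk (quantTable T X) (p :: l)
    have hleg := legal_plan (k := k) (seen := reqs.take (l.length + 1)) i (p := p) l
      (after k T (quantTable T X) l) (by rw [hreqs]; simp)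
      ((Finset.card_le_card (hinv.R_sub i)).trans (hinv.card_V i))
    rw [← hc] at hleg
    obtain ⟨n', s', h1, h2, h3, h4, h5⟩ := run_plan (i := i) hreqs hget h₀ hm _ [] s hs (by simp)
      (by simp) (by simpa using hleg.ne_serve) hrec hleg (by simp [nextR])
    refine ⟨n' + n, s', ?_, by simpa using h2, h3, Or.inr ⟨_, h4⟩, h5, fun q => ?_, ?_⟩
    · exact (run_add _ _ _ _ _ _ _).trans (hrun ▸ h1)
    · rw [h4, List.nil_append]
      simp only [after, LaneState.round]
      have hq := hm q
      split_ifs with hd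
      · by_cases hqp : q = p
        · subst hqp
          rw [Function.update_self]
          -- The forced eviction ensures that this lane has received at least as many samples of `q`
          -- as the simulation uses.
          have : 0 < (plan k i q l (after k T (quantTable T X) l)).reverse.count (.evict q) := by
            rw [List.count_pos_iff]
            simp [plan, hd]
          simp only [List.count_cons, List.count_append]
          omega
        · rw [Function.update_of_ne hqp]
          simp only [List.count_cons, List.count_append]
          omega
      · simp only [List.count_cons, List.count_append]
        omega
    · rw [h4, List.nil_append, laneCost, List.map_cons, List.sum_cons, List.map_append,
        List.sum_append, hcost, List.map_reverse, List.sum_reverse, plan_cost]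
      simp only [Op.cost, zero_add]
      rw [add_comm]
      rfl

lemma lanesAlgorithm_servesAll (Page : Type) [DecidableEq Page] {k : ℕ} (hk : 1 ≤ k) (T : ℕ) :
    (lanesAlgorithm Page k T).ServesAll k T := by
  intro reqs hreqs i X _
  obtain ⟨n, s, hrun, hs, -⟩ := run_after (reqs := reqs) (i := i) (X := X) hk (fun _ => 0)
    reqs.reverse List.suffix_rfl
  refine ⟨n, ?_⟩
  have e : (lanesAlgorithm Page k T).run k reqs i X n = s := hrun
  rw [e, hs, List.length_reverse, hreqs]

lemma step_cost_le (A : OnlineAlgorithm Page) {w : Page → ℝ} (hw : ∀ q, 0 ≤ w q) (ω : A.Seed)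
    (s : State Page) :
    (s.ops.map (Op.cost w)).sum ≤ ((A.step k reqs ω X s).ops.map (Op.cost w)).sum := by
  unfold OnlineAlgorithm.step
  split
  · exact le_rfl
  · split
    · split_ifs
      · simp only [List.map_cons, List.sum_cons, Op.cost]
        linarith [hw ‹_›]
      · exact le_rfl
    · split_ifs
      · simp [Op.cost]
      · exact le_rfl
    · split_ifs
      · simp [Op.cost]
      · exact le_rfl

lemma run_cost_mono (A : OnlineAlgorithm Page) {w : Page → ℝ} (hw : ∀ q, 0 ≤ w q) (ω : A.Seed) :
    Monotone fun N => ((A.run k reqs ω X N).ops.map (Op.cost w)).sum := by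
  refine monotone_nat_of_le_succ fun N => ?_
  rw [run_succ]
  exact step_cost_le A hw ω _

/-- The accumulated cost is monotone, and the run is constant once all requests are served, so the
supremum is the value at that time. -/
lemma lanesAlgorithm_cost (hk : 1 ≤ k) (Q : Input Page) (hw : ∀ q, 0 ≤ Q.weight q) :
    (lanesAlgorithm Page k T).cost k Q i X =
      ENNReal.ofReal (laneCost k T (quantTable T X) Q.weight i Q.requests.reverse) := by
  obtain ⟨n, s, hrun, hs, -, -, -, -, hcost⟩ := run_after (reqs := Q.requests) (i := i) (X := X)
    hk Q.weight Q.requests.reverse List.suffix_rfl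
  have hstuck : ∀ m, (lanesAlgorithm Page k T).run k Q.requests i X (m + n) = s := by
    intro m
    induction m with
    | zero => rw [zero_add]; exact hrun
    | succ m ih =>
      rw [show m + 1 + n = (m + n) + 1 by ring]
      refine (run_succ _ _ _ _ _ _).trans ?_
      rw [ih]
      exact step_of_none _ _ _ (by rw [hs, List.length_reverse, List.getElem?_eq_none le_rfl])
  have hmono := run_cost_mono (k := k) (reqs := Q.requests) (X := X) (lanesAlgorithm Page k T) hw i
  unfold OnlineAlgorithm.cost
  rw [← hcost]
  refine le_antisymm (iSup_le fun N => ENNReal.ofReal_le_ofReal ?_) ?_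
  · have h := hmono (Nat.le_add_right N n)
    simp only at h
    rwa [hstuck N] at h
  · refine le_iSup_of_le n ?_
    rw [hrun]

end Run

end

/-! ### Concentration of the samples -/

open ProbabilityTheory

section

variable {Page : Type}

namespace Input

variable (Q : Input Page)

instance : IsProbabilityMeasure Q.sampleLaw := by unfold sampleLaw; infer_instance

lemma integrable_exp_dist (p : Page) (t : ℝ) : Integrable (fun x => Real.exp (t * x)) (Q.dist p) := by
  refine Integrable.of_bound (by fun_prop) (Real.exp |t|) ?_
  filter_upwards [Q.support p] with x hx
  rw [Real.norm_eq_abs, abs_of_pos (Real.exp_pos _), Real.exp_le_exp]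
  calc t * x ≤ |t| * x := by gcongr; exacts [hx.1.le, le_abs_self t]
    _ ≤ |t| := mul_le_of_le_one_right (abs_nonneg _) hx.2

lemma integrable_id_dist (p : Page) : Integrable (fun x => x) (Q.dist p) := by
  refine Integrable.of_bound (by fun_prop) 1 ?_
  filter_upwards [Q.support p] with x hx
  rw [Real.norm_eq_abs, abs_of_pos hx.1]
  exact hx.2

lemma weight_nonneg (p : Page) : 0 ≤ Q.weight p :=
  integral_nonneg_of_ae (by filter_upwards [Q.support p] with x hx using hx.1.le)

lemma weight_le_one (p : Page) : Q.weight p ≤ 1 := by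
  have : ∫ x, x ∂(Q.dist p) ≤ ∫ _x, (1 : ℝ) ∂(Q.dist p) :=
    integral_mono_ae (Q.integrable_id_dist p) (integrable_const _)
      (by filter_upwards [Q.support p] with x hx using hx.2)
  simpa [weight] using this

lemma mgf_sample (i : Page × ℕ) (t : ℝ) :
    mgf (fun X : Page × ℕ → ℝ => X i) Q.sampleLaw t = ∫ x, Real.exp (t * x) ∂(Q.dist i.1) := by
  have h := Measure.infinitePi_map_eval (fun i : Page × ℕ => Q.dist i.1) i
  rw [← h, integral_map (measurable_pi_apply i).aemeasurable (by fun_prop)]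
  rfl

lemma integral_affine (p : Page) (c : ℝ) :
    ∫ x, (1 + c * x) ∂(Q.dist p) = 1 + c * Q.weight p := by
  rw [integral_add (integrable_const _) ((Q.integrable_id_dist p).const_mul c), integral_const_mul]
  simp [weight]

/-- On `(0, 1]` one has `exp x ≤ 1 + x + x² ≤ 1 + 2x`. -/
lemma mgf_one_le (i : Page × ℕ) :
    mgf (fun X : Page × ℕ → ℝ => X i) Q.sampleLaw 1 ≤ Real.exp (2 * Q.weight i.1) := by
  rw [mgf_sample]
  have h : ∫ x, Real.exp (1 * x) ∂(Q.dist i.1) ≤ ∫ x, (1 + 2 * x) ∂(Q.dist i.1) := by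
    refine integral_mono_ae (Q.integrable_exp_dist _ 1)
      ((integrable_const _).add ((Q.integrable_id_dist _).const_mul 2)) ?_
    filter_upwards [Q.support i.1] with x hx
    have := (abs_le.1 (Real.abs_exp_sub_one_sub_id_le (x := x) (by
      rw [abs_of_pos hx.1]; exact hx.2))).2
    simp only [one_mul]
    nlinarith [hx.1, hx.2]
  rw [integral_affine] at h
  exact h.trans (by rw [add_comm]; exact Real.add_one_le_exp _)

/-- On `(0, 1]` one has `exp (-x/2) ≤ 1 - x/2 + x²/4 ≤ 1 - x/4`. -/
lemma mgf_neg_half_le (i : Page × ℕ) :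
    mgf (fun X : Page × ℕ → ℝ => X i) Q.sampleLaw (-1 / 2) ≤ Real.exp (-1 / 4 * Q.weight i.1) := by
  rw [mgf_sample]
  have h : ∫ x, Real.exp (-1 / 2 * x) ∂(Q.dist i.1) ≤ ∫ x, (1 + -1 / 4 * x) ∂(Q.dist i.1) := by
    refine integral_mono_ae (Q.integrable_exp_dist _ _)
      ((integrable_const _).add ((Q.integrable_id_dist _).const_mul _)) ?_
    filter_upwards [Q.support i.1] with x hx
    have := (abs_le.1 (Real.abs_exp_sub_one_sub_id_le (x := -1 / 2 * x) (by
      rw [abs_le]; constructor <;> linarith [hx.1, hx.2]))).2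
    nlinarith [hx.1, hx.2]
  rw [integral_affine] at h
  exact h.trans (by rw [add_comm]; exact Real.add_one_le_exp _)

lemma iIndepFun_samples (p : Page) :
    iIndepFun (fun (j : ℕ) (X : Page × ℕ → ℝ) => X (p, j)) Q.sampleLaw := by
  have h : iIndepFun (fun (i : Page × ℕ) (X : Page × ℕ → ℝ) => X i) Q.sampleLaw :=
    iIndepFun_infinitePi (P := fun i : Page × ℕ => Q.dist i.1) (X := fun _ x => x)
      fun _ => measurable_id
  exact h.precomp (g := fun j : ℕ => (p, j)) fun a b hab => by simpa using hab

lemma integrable_exp_sample (i : Page × ℕ) (t : ℝ) :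
    Integrable (fun X : Page × ℕ → ℝ => Real.exp (t * X i)) Q.sampleLaw := by
  have h := Measure.infinitePi_map_eval (fun i : Page × ℕ => Q.dist i.1) i
  have h' := Q.integrable_exp_dist i.1 t
  rw [← h] at h'
  exact (integrable_map_measure (f := fun X : Page × ℕ → ℝ => X i)
    (g := fun x => Real.exp (t * x)) (by fun_prop) (measurable_pi_apply i).aemeasurable).1 h'

lemma integrable_exp_sum (p : Page) (m : ℕ) (t : ℝ) :
    Integrable (fun X => Real.exp (t * (∑ j ∈ Finset.range m,
      fun X : Page × ℕ → ℝ => X (p, j)) X)) Q.sampleLaw :=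
  (Q.iIndepFun_samples p).integrable_exp_mul_sum (fun j => by fun_prop)
    fun j _ => Q.integrable_exp_sample (p, j) t

/-- Chernoff bound at parameter 1. The multiplicative slack 2 makes the failure probability
independent of `m` and of the weight. -/
lemma measure_sum_ge_le (p : Page) (m : ℕ) (L : ℝ) :
    Q.sampleLaw.real {X | 2 * m * Q.weight p + L ≤ ∑ j ∈ Finset.range m, X (p, j)} ≤
      Real.exp (-L) := by
  have h := measure_ge_le_exp_mul_mgf (μ := Q.sampleLaw) (t := 1)
    (X := ∑ j ∈ Finset.range m, fun X : Page × ℕ → ℝ => X (p, j)) (2 * m * Q.weight p + L)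
    zero_le_one (Q.integrable_exp_sum p m 1)
  simp only [Finset.sum_apply] at h
  refine h.trans ?_
  rw [(Q.iIndepFun_samples p).mgf_sum (fun j => by fun_prop)]
  have h2 : ∏ j ∈ Finset.range m, mgf (fun X : Page × ℕ → ℝ => X (p, j)) Q.sampleLaw 1 ≤
      ∏ _j ∈ Finset.range m, Real.exp (2 * Q.weight p) :=
    Finset.prod_le_prod (fun _ _ => mgf_nonneg) fun j _ => Q.mgf_one_le (p, j)
  rw [Finset.prod_const, Finset.card_range, ← Real.exp_nat_mul] at h2
  calc _ ≤ Real.exp (-1 * (2 * m * Q.weight p + L)) * Real.exp (m * (2 * Q.weight p)) := by gcongr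
    _ = Real.exp (-L) := by rw [← Real.exp_add]; congr 1; ring

lemma measure_sum_le_le (p : Page) (m : ℕ) (L : ℝ) :
    Q.sampleLaw.real {X | ∑ j ∈ Finset.range m, X (p, j) ≤ m * Q.weight p / 2 - 2 * L} ≤
      Real.exp (-L) := by
  have h := measure_le_le_exp_mul_mgf (μ := Q.sampleLaw) (t := -1 / 2)
    (X := ∑ j ∈ Finset.range m, fun X : Page × ℕ → ℝ => X (p, j)) (m * Q.weight p / 2 - 2 * L)
    (by norm_num) (Q.integrable_exp_sum p m _)
  simp only [Finset.sum_apply] at h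
  refine h.trans ?_
  rw [(Q.iIndepFun_samples p).mgf_sum (fun j => by fun_prop)]
  have h2 : ∏ j ∈ Finset.range m, mgf (fun X : Page × ℕ → ℝ => X (p, j)) Q.sampleLaw (-1 / 2) ≤
      ∏ _j ∈ Finset.range m, Real.exp (-1 / 4 * Q.weight p) :=
    Finset.prod_le_prod (fun _ _ => mgf_nonneg) fun j _ => Q.mgf_neg_half_le (p, j)
  rw [Finset.prod_const, Finset.card_range, ← Real.exp_nat_mul] at h2
  calc _ ≤ Real.exp (-(-1 / 2) * (m * Q.weight p / 2 - 2 * L)) *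
        Real.exp (m * (-1 / 4 * Q.weight p)) := by gcongr
    _ = Real.exp (-L) := by rw [← Real.exp_add]; congr 1; ring

lemma ae_sample_mem (i : Page × ℕ) : ∀ᵐ X ∂Q.sampleLaw, X i ∈ Set.Ioc (0 : ℝ) 1 := by
  have h := Measure.infinitePi_map_eval (fun i : Page × ℕ => Q.dist i.1) i
  have h' := Q.support i.1
  rw [← h] at h'
  exact ae_of_ae_map (measurable_pi_apply i).aemeasurable h'

/-- The samples of the pages in `P` are in `(0, 1]`, and their partial sums up to `T` are
concentrated, with deviation parameter `L`. -/
def Concentrated (P : Finset Page) (T : ℕ) (L : ℝ) (X : Page × ℕ → ℝ) : Prop :=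
  (∀ p ∈ P, ∀ j, X (p, j) ∈ Set.Ioc (0 : ℝ) 1) ∧
  ∀ p ∈ P, ∀ m ≤ T, ∑ j ∈ Finset.range m, X (p, j) ≤ 2 * m * Q.weight p + L ∧
    m * Q.weight p / 2 - 2 * L ≤ ∑ j ∈ Finset.range m, X (p, j)

/-- Union bound over pages and all sample counts up to `T`: the number of samples used depends on
the samples, so all counts must be controlled at once. -/
lemma measure_not_concentrated_le (P : Finset Page) (T : ℕ) (L : ℝ) :
    Q.sampleLaw {X | ¬ Q.Concentrated P T L X} ≤
      ENNReal.ofReal (P.card * (T + 1) * (2 * Real.exp (-L))) := by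
  set U : Page → ℕ → Set (Page × ℕ → ℝ) := fun p m =>
    {X | 2 * m * Q.weight p + L ≤ ∑ j ∈ Finset.range m, X (p, j)} ∪
    {X | ∑ j ∈ Finset.range m, X (p, j) ≤ m * Q.weight p / 2 - 2 * L} with hU
  have hsub : {X | ¬ Q.Concentrated P T L X} ≤ᵐ[Q.sampleLaw]
      ⋃ p ∈ P, ⋃ m ∈ Finset.range (T + 1), U p m := by
    have hae : ∀ᵐ X ∂Q.sampleLaw, ∀ p ∈ P, ∀ j, X (p, j) ∈ Set.Ioc (0 : ℝ) 1 := by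
      refine (Filter.eventually_all_finset P).2 fun p _ => ?_
      rw [ae_all_iff]
      exact fun j => Q.ae_sample_mem (p, j)
    filter_upwards [hae] with X hX
    intro hn
    by_contra hnot
    refine hn ⟨hX, fun p hp m hm => ?_⟩
    have : X ∉ U p m := fun h => hnot (by
      show X ∈ ⋃ p ∈ P, ⋃ m ∈ Finset.range (T + 1), U p m
      simp only [Set.mem_iUnion]
      exact ⟨p, hp, m, Finset.mem_range.2 (by omega), h⟩)
    simp only [hU, Set.mem_union, Set.mem_ofPred_eq, not_or, not_le] at this
    exact ⟨this.1.le, this.2.le⟩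
  have hone : ∀ p m, Q.sampleLaw (U p m) ≤ ENNReal.ofReal (2 * Real.exp (-L)) := by
    intro p m
    refine (measure_union_le _ _).trans ?_
    rw [two_mul (Real.exp (-L)), ENNReal.ofReal_add (Real.exp_pos _).le (Real.exp_pos _).le]
    refine add_le_add ?_ ?_
    · rw [← ofReal_measureReal]
      exact ENNReal.ofReal_le_ofReal (Q.measure_sum_ge_le p m L)
    · rw [← ofReal_measureReal]
      exact ENNReal.ofReal_le_ofReal (Q.measure_sum_le_le p m L)
  refine (measure_mono_ae hsub).trans ((measure_biUnion_finset_le _ _).trans ?_)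
  calc ∑ p ∈ P, Q.sampleLaw (⋃ m ∈ Finset.range (T + 1), U p m)
      ≤ ∑ p ∈ P, ∑ m ∈ Finset.range (T + 1), ENNReal.ofReal (2 * Real.exp (-L)) :=
        Finset.sum_le_sum fun p _ => (measure_biUnion_finset_le _ _).trans
          (Finset.sum_le_sum fun m _ => hone p m)
    _ = _ := by
        rw [Finset.sum_const, Finset.sum_const, Finset.card_range, nsmul_eq_mul, nsmul_eq_mul,
          ← ENNReal.ofReal_natCast, ← ENNReal.ofReal_natCast (T + 1),
          ← ENNReal.ofReal_mul (by positivity), ← ENNReal.ofReal_mul (by positivity)]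
        push_cast
        rw [mul_assoc]

end Input

end

/-! ### From concentration to the expected cost -/

section

variable {Page : Type} [DecidableEq Page]

open LaneState

lemma le_quantize_div (T : ℕ) {x : ℝ} (hx : 0 ≤ x) :
    x ≤ (quantize T x : ℝ) / (T + 1) ∧ (quantize T x : ℝ) / (T + 1) ≤ x + 1 / (T + 1) := by
  have hT : (0 : ℝ) < T + 1 := by positivity
  unfold quantize
  constructor
  · rw [le_div_iff₀ hT]
    exact Nat.le_ceil _
  · rw [div_le_iff₀ hT, add_mul, one_div, inv_mul_cancel₀ hT.ne']
    exact (Nat.ceil_lt_add_one (by positivity)).le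

lemma weightClass_spec {T m s : ℕ} (h0 : Plausible T m s 0) :
    Plausible T m s (weightClass T m s) :=
  @Nat.findGreatest_spec 0 (Plausible T m s) (Classical.decPred _) T (Nat.zero_le _) h0

lemma not_plausible_succ {T m s : ℕ} (h : weightClass T m s < T) :
    ¬ Plausible T m s (weightClass T m s + 1) :=
  @Nat.findGreatest_is_greatest _ (Plausible T m s) (Classical.decPred _) T
    (Nat.lt_succ_self _) h

section Concentration

variable {k T : ℕ} {Q : Input Page} {P : Finset Page} {X : Page × ℕ → ℝ}

/-- Rounding up adds at most `1 / (T + 1)` per sample, hence at most 1 in all. -/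
lemma sampleSum_bounds {l : List Page} (hk : 1 ≤ k) (hl : l.length ≤ T)
    (hX : Q.Concentrated P T (3 * Real.log T) X) {q : Page} (hq : q ∈ P) :
    let σ := after k T (quantTable T X) l
    σ.m q * Q.weight q / 2 - 2 * (3 * Real.log T) ≤ (σ.s q : ℝ) / (T + 1) ∧
      (σ.s q : ℝ) / (T + 1) ≤ 2 * σ.m q * Q.weight q + 3 * Real.log T + 1 ∧
      (σ.s q : ℝ) / (T + 1) ≤ σ.m q + 1 := by
  intro σ
  have hT : (0 : ℝ) < T + 1 := by positivity
  have hm : σ.m q ≤ T := (m_le_length hk _ l q).trans hl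
  have hm' : (σ.m q : ℝ) * (1 / (T + 1)) ≤ 1 := by
    rw [mul_one_div, div_le_one hT]
    have : (σ.m q : ℝ) ≤ T := by exact_mod_cast hm
    linarith
  have hs : (σ.s q : ℝ) / (T + 1) =
      ∑ j ∈ Finset.range (σ.m q), (quantTable T X q j : ℝ) / (T + 1) := by
    rw [← Finset.sum_div, ← Nat.cast_sum, ← s_after]
  have h1 : ∑ j ∈ Finset.range (σ.m q), X (q, j) ≤ (σ.s q : ℝ) / (T + 1) := by
    rw [hs]
    exact Finset.sum_le_sum fun j _ => (le_quantize_div T (hX.1 q hq j).1.le).1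
  have h2 : (σ.s q : ℝ) / (T + 1) ≤ ∑ j ∈ Finset.range (σ.m q), X (q, j) + 1 := by
    rw [hs]
    refine (Finset.sum_le_sum fun j _ => (le_quantize_div T (hX.1 q hq j).1.le).2).trans ?_
    rw [Finset.sum_add_distrib, Finset.sum_const, Finset.card_range, nsmul_eq_mul]
    linarith
  have h3 : ∑ j ∈ Finset.range (σ.m q), X (q, j) ≤ σ.m q := by
    refine (Finset.sum_le_sum fun j _ => (hX.1 q hq j).2).trans ?_
    simp
  have h4 := hX.2 q hq (σ.m q) hm
  exact ⟨by linarith, by linarith, by linarith⟩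

/-- Below the cap `T`, half the estimate is implausible, so the sample sum exceeds `2 m wt + 3 log T
+ 1`; concentration bounds it by the same expression with the true weight. -/
lemma wt_le_of_concentrated {l : List Page} (hk : 1 ≤ k) (hl : l.length ≤ T)
    (hX : Q.Concentrated P T (3 * Real.log T) X) {q : Page} (hq : q ∈ P) :
    (after k T (quantTable T X) l).wt q ≤ Q.weight q + (1 / 2) ^ T := by
  obtain ⟨-, h, -⟩ := sampleSum_bounds hk hl hX hq
  set σ := after k T (quantTable T X) l
  rcases (weightClass_le T (σ.m q) (σ.s q)).eq_or_lt with he | hlt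
  · have : σ.wt q = (1 / 2) ^ T := by rw [wt, cl, he]
    rw [this]
    linarith [Q.weight_nonneg q]
  · have hn := not_plausible_succ hlt
    rw [Plausible, not_le, pow_succ] at hn
    have e : (1 / 2 : ℝ) ^ weightClass T (σ.m q) (σ.s q) = σ.wt q := rfl
    rw [e] at hn
    have hε : (0 : ℝ) < (1 / 2) ^ T := by positivity
    by_contra! hc
    have : (σ.m q : ℝ) * Q.weight q ≤ σ.m q * σ.wt q := by
      gcongr
      linarith
    linarith

/-- With weight `w`, plausibility gives a sample sum of at most `m w / 4 + 3 log T + 1`, and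
concentration at least `m w / 2 - 6 log T`. Hence `m w ≤ 36 log T + 4`. -/
lemma weight_mul_m_le_of_concentrated {l : List Page} (hk : 1 ≤ k) (hl : l.length ≤ T)
    (hX : Q.Concentrated P T (3 * Real.log T) X) {q : Page} (hq : q ∈ P)
    (hwt : (after k T (quantTable T X) l).wt q ≤ Q.weight q / 16) :
    Q.weight q * (after k T (quantTable T X) l).m q + 2 ≤ 36 * Real.log T + 6 := by
  obtain ⟨h1, -, h3⟩ := sampleSum_bounds hk hl hX hq
  set σ := after k T (quantTable T X) l
  have hlog : 0 ≤ Real.log T := Real.log_natCast_nonneg T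
  have hm : (0 : ℝ) ≤ σ.m q := Nat.cast_nonneg _
  -- Samples are at most 1, so class 0 is plausible and the search does not fall back to its
  -- default.
  have h0 : Plausible T (σ.m q) (σ.s q) 0 := by
    rw [Plausible, pow_zero]
    linarith
  have h4 := weightClass_spec h0
  rw [Plausible] at h4
  have e : (1 / 2 : ℝ) ^ weightClass T (σ.m q) (σ.s q) = σ.wt q := rfl
  rw [e] at h4
  have h5 := mul_le_mul_of_nonneg_left hwt hm
  linarith

/-- The average cost of the lanes if the samples are concentrated. -/
lemma average_laneCost_le (hk : 1 ≤ k) (hT : Q.requests.length = T)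
    (hX : Q.Concentrated Q.requests.toFinset T (3 * Real.log T) X)
    {C : ℕ → Finset Page} (hC : Q.IsSchedule k C) :
    (∑ i, laneCost k T (quantTable T X) Q.weight i Q.requests.reverse) / (T + 1) ≤
      768 * Real.log (2 * k + 1) * (Q.scheduleCost C + 1) + 1056 * Q.numPages + 192
        + 2 * Q.numPages * (36 * Real.log T + 6) := by
  have hlog : 0 ≤ Real.log T := Real.log_natCast_nonneg T
  have hT0 : (0 : ℝ) < T + 1 := by positivity
  have hlen : Q.requests.reverse.length = T := by rw [List.length_reverse, hT]
  have hfin : Q.requests.reverse.toFinset = Q.requests.toFinset := List.toFinset_reverse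
  have hsuf : ∀ l' : List Page, l' <:+ Q.requests.reverse → l'.length ≤ T := fun l' h =>
    hlen ▸ h.length_le
  have hserve : ∀ p l', (p :: l') <:+ Q.requests.reverse → p ∈ C (l'.length + 1) := by
    rintro p l' ⟨r, hr⟩
    have e : Q.requests = l'.reverse ++ p :: r.reverse := by
      have := congrArg List.reverse hr
      rw [List.reverse_reverse] at this
      rw [← this]; simp
    have hlt : l'.length < Q.requests.length := by rw [e]; simp
    have h := hC.serves l'.length hlt
    have e' : Q.requests[l'.length]? = some p := by
      rw [e, List.getElem?_append_right (by simp)]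
      simp
    rw [List.getElem?_eq_getElem hlt, Option.some_inj] at e'
    rwa [e'] at h
  have h1 := sum_laneCost_le (T := T) hk (quantTable T X) Q.weight_nonneg Q.requests.reverse
  have h2 : ∑ q ∈ Q.requests.reverse.toFinset,
      Q.weight q * (after k T (quantTable T X) Q.requests.reverse).D q ≤
      ∑ q ∈ Q.requests.reverse.toFinset, (16 * charge k T (quantTable T X) Q.requests.reverse q +
        (36 * Real.log T + 6) * (T + 1)) := by
    refine Finset.sum_le_sum fun q hq => weight_mul_D_le hk _ (Q.weight_nonneg q)
      (Q.weight_le_one q) (by positivity) q fun l' hl' hwt => ?_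
    rw [hfin] at hq
    exact weight_mul_m_le_of_concentrated hk (hsuf l' hl') hX hq hwt
  have h3 := sum_charge_le (T := T) hk (quantTable T X) Q.weight_nonneg hC.card_le hlen hserve
    fun l' hl' q hq => by
      rw [hfin] at hq
      exact wt_le_of_concentrated hk (hsuf l' hl') hX hq
  have hcost : ∑ t ∈ Finset.range T, ∑ q ∈ C t \ C (t + 1), Q.weight q = Q.scheduleCost C := by
    rw [Input.scheduleCost, Input.numRequests, hT]
  rw [hcost] at h3
  rw [Finset.sum_add_distrib, ← Finset.mul_sum, Finset.sum_const, nsmul_eq_mul] at h2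
  rw [hfin] at h1 h2 h3
  have hn : Q.requests.toFinset.card = Q.numPages := rfl
  rw [hn] at h2 h3
  have h4 : (∑ i, laneCost k T (quantTable T X) Q.weight i Q.requests.reverse) / (T + 1) ≤
      32 * ((∑ q ∈ Q.requests.toFinset, charge k T (quantTable T X) Q.requests.reverse q) / (T + 1))
        + 2 * Q.numPages * (36 * Real.log T + 6) := by
    rw [div_le_iff₀ hT0, add_mul, mul_assoc 32, div_mul_cancel₀ _ hT0.ne']
    linarith
  linarith

end Concentration

section Measurability

variable {k T : ℕ}

lemma laneCost_congr (hk : 1 ≤ k) (Y Y' : Page → ℕ → ℕ) (w : Page → ℝ) (i : Fin (T + 1))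
    (l : List Page) (h : ∀ q ∈ l, ∀ j < l.length, Y q j = Y' q j) :
    laneCost k T Y w i l = laneCost k T Y' w i l := by
  have hafter : ∀ l' : List Page, (∀ q ∈ l', ∀ j < l'.length, Y q j = Y' q j) →
      after k T Y l' = after k T Y' l' := by
    intro l' h'
    refine after_congr k Y Y' l' fun q j hj => ?_
    by_cases hq : q ∈ l'
    · exact h' q hq j (hj.trans_le (m_le_length hk Y l' q))
    · have hinv := inv_after (T := T) hk Y l'
      have h1 := hinv.m_le q
      have h2 := hinv.D_le_count q
      rw [List.count_eq_zero_of_not_mem hq] at h2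
      have h3 : (after k T Y l').m q * (T + 1) = 0 := by omega
      have h4 : (after k T Y l').m q = 0 := by simpa using h3
      omega
  induction l with
  | nil => rfl
  | cons p l ih =>
    have h' : ∀ q ∈ l, ∀ j < l.length, Y q j = Y' q j := fun q hq j hj =>
      h q (List.mem_cons_of_mem _ hq) j (hj.trans (by simp))
    rw [laneCost, laneCost, ih h', hafter l h', hafter (p :: l) h]

/-- The cost depends on finitely many quantized samples, so it factors through a countable discrete
space. -/
lemma measurable_laneCost (hk : 1 ≤ k) (w : Page → ℝ) (i : Fin (T + 1)) (l : List Page) :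
    Measurable fun X : Page × ℕ → ℝ => laneCost k T (quantTable T X) w i l := by
  let extend : ({q // q ∈ l} × Fin l.length → ℕ) → Page → ℕ → ℕ := fun u q j =>
    if h : q ∈ l ∧ j < l.length then u (⟨q, h.1⟩, ⟨j, h.2⟩) else 0
  have e : (fun X : Page × ℕ → ℝ => laneCost k T (quantTable T X) w i l) =
      (fun u => laneCost k T (extend u) w i l) ∘
        (fun (X : Page × ℕ → ℝ) (a : {q // q ∈ l} × Fin l.length) =>
          quantize T (X (a.1.1, a.2.1))) := by
    funext X
    refine laneCost_congr hk _ _ w i l fun q hq j hj => ?_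
    simp only [extend, dif_pos (And.intro hq hj)]
    rfl
  rw [e]
  have : Finite {q // q ∈ l} := l.finite_toSet
  refine Measurable.comp Measurable.of_discrete (measurable_pi_lambda _ fun a => ?_)
  unfold quantize
  fun_prop

/-- All lanes are coupled through the same sample table, so averaging over the seed averages the
lanes of a single simulation. -/
lemma expectedCost_eq (hk : 1 ≤ k) (Q : Input Page) :
    (lanesAlgorithm Page k T).expectedCost k Q = ∫⁻ X, ENNReal.ofReal
      ((∑ i, laneCost k T (quantTable T X) Q.weight i Q.requests.reverse) / (T + 1))
      ∂Q.sampleLaw := by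
  have h1 : (lanesAlgorithm Page k T).expectedCost k Q =
      ∫⁻ z : Fin (T + 1) × (Page × ℕ → ℝ), ENNReal.ofReal
        (laneCost k T (quantTable T z.2) Q.weight z.1 Q.requests.reverse)
        ∂((PMF.uniformOfFintype (Fin (T + 1))).toMeasure.prod Q.sampleLaw) := by
    unfold OnlineAlgorithm.expectedCost
    refine lintegral_congr fun z => ?_
    exact lanesAlgorithm_cost hk Q Q.weight_nonneg
  have hmeas : ∀ i, Measurable fun X : Page × ℕ → ℝ => ENNReal.ofReal
      (laneCost k T (quantTable T X) Q.weight i Q.requests.reverse) := fun i =>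
    (measurable_laneCost hk _ i _).ennreal_ofReal
  rw [h1, lintegral_prod _ (measurable_from_prod_countable_right hmeas).aemeasurable,
    lintegral_fintype]
  have h2 : ∀ i : Fin (T + 1), (PMF.uniformOfFintype (Fin (T + 1))).toMeasure {i} =
      ENNReal.ofReal (1 / (T + 1)) := by
    intro i
    rw [PMF.toMeasure_apply_singleton _ _ (measurableSet_singleton i), PMF.uniformOfFintype_apply,
      Fintype.card_fin, one_div, ENNReal.ofReal_inv_of_pos (by positivity), ← Nat.cast_succ,
      ENNReal.ofReal_natCast]
  simp only [h2]
  rw [← Finset.sum_mul, ← lintegral_finsetSum _ fun i _ => hmeas i,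
    ← lintegral_mul_const _ (Finset.measurable_sum _ fun i _ => hmeas i)]
  refine lintegral_congr fun X => ?_
  rw [← ENNReal.ofReal_sum_of_nonneg fun i _ => laneCost_nonneg _ _ _ Q.weight_nonneg _ _,
    ← ENNReal.ofReal_mul (Finset.sum_nonneg fun i _ =>
      laneCost_nonneg _ _ _ Q.weight_nonneg _ _), mul_one_div]

end Measurability

/-- The deviation `3 log T` makes the bad event have probability at most `2 T (T + 1) / T³`; times
the crude bound `2T` this is at most 8. -/
lemma expectedCost_le {k T : ℕ} (hk : 1 ≤ k) (Q : Input Page) (hT : Q.requests.length = T) {B : ℝ}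
    (hB0 : 0 ≤ B)
    (hB : ∀ X, Q.Concentrated Q.requests.toFinset T (3 * Real.log T) X →
      (∑ i, laneCost k T (quantTable T X) Q.weight i Q.requests.reverse) / (T + 1) ≤ B) :
    (lanesAlgorithm Page k T).expectedCost k Q ≤ ENNReal.ofReal (B + 8) := by
  rw [expectedCost_eq hk]
  set bad : Set (Page × ℕ → ℝ) :=
    {X | ¬ Q.Concentrated Q.requests.toFinset T (3 * Real.log T) X} with hbad
  have hbound : ∀ X, ENNReal.ofReal
      ((∑ i, laneCost k T (quantTable T X) Q.weight i Q.requests.reverse) / (T + 1)) ≤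
      ENNReal.ofReal B + bad.indicator (fun _ => ENNReal.ofReal (2 * T)) X := by
    intro X
    by_cases hX : X ∈ bad
    · rw [Set.indicator_of_mem hX]
      refine le_add_left (ENNReal.ofReal_le_ofReal ?_)
      rw [div_le_iff₀ (by positivity)]
      have := sum_laneCost_le_length (T := T) hk (quantTable T X) Q.weight_nonneg Q.weight_le_one
        Q.requests.reverse
      rwa [List.length_reverse, hT] at this
    · rw [Set.indicator_of_notMem hX, add_zero]
      refine ENNReal.ofReal_le_ofReal (hB X ?_)
      by_contra hn
      exact hX hn
  refine (lintegral_mono hbound).trans ?_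
  rw [lintegral_add_left measurable_const, lintegral_const, measure_univ, mul_one,
    ENNReal.ofReal_add hB0 (by norm_num)]
  gcongr
  refine (lintegral_indicator_const_le _ _).trans ?_
  refine (mul_le_mul_right (Q.measure_not_concentrated_le _ _ _) _).trans ?_
  rw [← ENNReal.ofReal_mul (by positivity)]
  refine ENNReal.ofReal_le_ofReal ?_
  rcases Nat.eq_zero_or_pos T with rfl | hTpos
  · simp
  have hT1 : (1 : ℝ) ≤ T := by exact_mod_cast hTpos
  have hexp : Real.exp (-(3 * Real.log T)) = ((T : ℝ) ^ 3)⁻¹ := by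
    rw [Real.exp_neg, mul_comm, Real.exp_mul, Real.exp_log (by linarith)]
    norm_cast
  have hcard : (Q.requests.toFinset.card : ℝ) ≤ T := by
    rw [← hT]
    exact_mod_cast List.toFinset_card_le _
  rw [hexp]
  calc 2 * (T : ℝ) * (Q.requests.toFinset.card * (T + 1) * (2 * ((T : ℝ) ^ 3)⁻¹))
      ≤ 2 * (T : ℝ) * (T * (T + T) * (2 * ((T : ℝ) ^ 3)⁻¹)) := by gcongr
    _ = 8 := by field_simp; norm_num

omit [DecidableEq Page] in
lemma exists_schedule {k : ℕ} (hk : 1 ≤ k) (Q : Input Page) :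
    ∃ C : ℕ → Finset Page, Q.IsSchedule k C := by
  refine ⟨fun t => match t with
    | 0 => ∅
    | t + 1 => if h : t < Q.requests.length then {Q.requests[t]} else ∅, rfl, fun t => ?_,
    fun t ht => ?_⟩
  · cases t with
    | zero => simp
    | succ t =>
      simp only
      split_ifs
      · simpa using hk
      · simp
  · simp [ht]

lemma log_two_mul_add_one_le (k : ℕ) : Real.log (2 * k + 1) ≤ 2 * Real.log (k + 1) := by
  rw [← Real.log_rpow (by positivity)]
  refine Real.log_le_log (by positivity) ?_
  norm_cast
  nlinarith

end

end OWPUW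

/-! ### The theorem -/

open OWPUW in
theorem theorem1 :
    ∃ (C₁ C₂ : ℝ) (c : ℕ), ∀ (Page : Type) [Countable Page] [DecidableEq Page],
      ∃ ON : ℕ → ℕ → OWPUW.OnlineAlgorithm Page, ∀ k T : ℕ, 1 ≤ k →
        (ON k T).ServesAll k T ∧
        ∀ Q : OWPUW.Input Page, Q.numRequests = T → k < Q.numPages →
          (ON k T).expectedCost k Q ≤
            ENNReal.ofReal (C₁ * Real.log (k + 1) * Q.opt k +
              C₂ * (Real.sqrt (Q.numPages * T) * Real.log (Q.numPages * T) ^ c)) := by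
  -- `1536 = 2 * 16 * 24 * 2`: sampling, estimation, potential, and `log (2k + 1) ≤ 2 log (k + 1)`.
  -- The value 3000 absorbs all additive terms, each at most a multiple of `n * log (nT)`.
  refine ⟨1536, 3000, 1, fun Page _ _ => ⟨lanesAlgorithm Page, fun k T hk =>
    ⟨lanesAlgorithm_servesAll Page hk T, fun Q hT hn => ?_⟩⟩⟩
  have hT' : Q.requests.length = T := hT
  have hk' : (1 : ℝ) ≤ k := by exact_mod_cast hk
  have hlogk : 0 < Real.log (k + 1) := Real.log_pos (by linarith)
  have hnT : Q.numPages ≤ T := hT ▸ List.toFinset_card_le _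
  have hn2 : 2 ≤ Q.numPages := by omega
  have hn2' : (2 : ℝ) ≤ Q.numPages := by exact_mod_cast hn2
  have hnT' : (Q.numPages : ℝ) ≤ T := by exact_mod_cast hnT
  have hlogT : 0 ≤ Real.log T := Real.log_natCast_nonneg T
  have hlogkn : Real.log (k + 1) ≤ Q.numPages := by
    have h1 := Real.log_le_sub_one_of_pos (show (0 : ℝ) < k + 1 by linarith)
    have h2 : (k : ℝ) ≤ Q.numPages := by exact_mod_cast hn.le
    linarith
  set Λ := Real.log (Q.numPages * T) with hΛ
  have hΛT : Real.log T ≤ Λ := Real.log_le_log (by linarith) (by nlinarith)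
  have hΛ1 : 1 ≤ Λ := by
    rw [hΛ, Real.le_log_iff_exp_le (by nlinarith)]
    have := Real.exp_one_lt_d9
    nlinarith
  have hsqrt : (Q.numPages : ℝ) ≤ Real.sqrt (Q.numPages * T) := by
    refine Real.le_sqrt_of_sq_le ?_
    nlinarith
  set R := 3000 * (Real.sqrt (Q.numPages * T) * Λ ^ 1) with hR
  have hRle : 3000 * (Q.numPages * Λ) ≤ R := by
    rw [hR, pow_one]
    gcongr
  have hopt : ∀ C : ℕ → Finset Page, Q.IsSchedule k C →
      (lanesAlgorithm Page k T).expectedCost k Q ≤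
        ENNReal.ofReal (1536 * Real.log (k + 1) * Q.scheduleCost C + R) := by
    intro C hC
    have hcost : 0 ≤ Q.scheduleCost C :=
      Finset.sum_nonneg fun t _ => Finset.sum_nonneg fun q _ => Q.weight_nonneg q
    have hlog2 : 0 ≤ Real.log (2 * k + 1) := Real.log_nonneg (by linarith)
    refine (expectedCost_le hk Q hT' ?_ fun X hX => average_laneCost_le hk hT' hX hC).trans
      (ENNReal.ofReal_le_ofReal ?_)
    · positivity
    · have h1 := mul_le_mul_of_nonneg_right (log_two_mul_add_one_le k)
        (show 0 ≤ Q.scheduleCost C + 1 by linarith)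
      have h2 := mul_le_mul_of_nonneg_left hΛT (show (0 : ℝ) ≤ Q.numPages by linarith)
      have h3 := mul_le_mul_of_nonneg_left hΛ1 (show (0 : ℝ) ≤ Q.numPages by linarith)
      nlinarith
  obtain ⟨C₀, hC₀⟩ := exists_schedule hk Q
  have hfin : (lanesAlgorithm Page k T).expectedCost k Q ≠ ⊤ :=
    ne_top_of_le_ne_top ENNReal.ofReal_ne_top (hopt C₀ hC₀)
  rw [← ENNReal.ofReal_toReal hfin]
  refine ENNReal.ofReal_le_ofReal ?_
  -- Solved for the schedule cost, the estimate is a lower bound for every schedule, so it passes to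
  -- the infimum without an optimal schedule.
  have hle : (((lanesAlgorithm Page k T).expectedCost k Q).toReal - R)
      / (1536 * Real.log (k + 1)) ≤ Q.opt k := by
    refine le_csInf ⟨_, C₀, hC₀, rfl⟩ ?_
    rintro _ ⟨C, hC, rfl⟩
    have hcost : 0 ≤ Q.scheduleCost C :=
      Finset.sum_nonneg fun t _ => Finset.sum_nonneg fun q _ => Q.weight_nonneg q
    have hR0 : 0 ≤ R := by positivity
    have := ENNReal.toReal_le_of_le_ofReal (by positivity) (hopt C hC)
    rw [div_le_iff₀ (by positivity)]
    linarith
  rw [div_le_iff₀ (by positivity)] at hle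
  linarith
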